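/- Let $N\ge 1$ and let $d_0,d_1,\dots,d_N$ be the widths of a linear network. Put $m=d_0$, $n=d_N$, $\underline d=\min\{d_0,\dots,d_N\}$, let $\Theta=\prod_{j=1}^N\mathbb R^{d_j\times d_{j-1}}$ be the parameter space and $\mu\colon\Theta\to\mathbb R^{n\times m}$, $\mu(W_1,\dots,W_N)=W_N\cdots W_1$. For $k\in\mathbb N$ let $\mathcal M(k)$ be the embedded submanifold of $\mathbb R^{n\times m}$ of matrices of rank exactly $k$. Let $\Sigma_0=\Omega\Lambda\Omega^\top$ with $\Omega\in\mathbb R^{n\times n}$ orthogonal and $\Lambda=\mathrm{diag}(\lambda_1,\dots,\lambda_n)$, $\lambda_1>\dots>\lambda_n>0$, and let $0<\tau\le\lambda_n$. Define the perturbed Bures--Wasserstein losses $$L^1_\tau(W)=\operatorname{tr}\Big(WW^\top+\tau I_n+\Sigma_0-2\big(\Sigma_0^{1/2}(WW^\top+\tau I_n)\Sigma_0^{1/2}\big)^{1/2}\Big)\quad(W\in\mathbb R^{n\times m}),\qquad L^N_\tau=L^1_\tau\circ\mu\quad\text{on }\Theta .$$ A critical point of $L^N_\tau$ is a point at which its differential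 vanishes; a critical point of $L^1_\tau|_{\mathcal M(k)}$ is a point of $\mathcal M(k)$ at which the differential of the restriction vanishes on the tangent space of $\mathcal M(k)$. 1. If $\theta\in\Theta$ is a critical point of $L^N_\tau$ and $k=\operatorname{rank}\mu(\theta)$, then $\mu(\theta)$ is a critical point of $L^1_\tau|_{\mathcal M(k)}$. 2. Let $\theta\in\Theta$ satisfy $\operatorname{rank}\mu(\theta)=\underline d$, and write $W=\mu(\theta)$. Then $\theta$ is a local minimizer of $L^N_\tau$ if and only if $W$ is a local minimizer of $L^1_\tau|_{\mathcal M(\underline d)}$, and this holds if and only if $W$ is a global minimizer of $L^1_\tau|_{\mathcal M(\underline d)}$. In this case $$WW^\top+\tau I_n=\Omega\,\mathrm{diag}(\lambda_1,\dots,\lambda_{\underline d},\tau,\dots,\tau)\,\Omega^\top .$$ -/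

import Mathlib

open scoped ContDiff Topology Matrix

noncomputable section

/-! ### Matrix square root and the Bures-Wasserstein loss -/

/-- The positive semidefinite square root of a real symmetric positive semidefinite matrix
(functional calculus for symmetric matrices). -/
def matSqrt {n : ℕ} (A : Matrix (Fin n) (Fin n) ℝ) : Matrix (Fin n) (Fin n) ℝ :=
  cfc Real.sqrt A

/-- The squared Bures-Wasserstein distance
`B²(S, S₀) = tr (S + S₀ - 2 (S₀^{1/2} S S₀^{1/2})^{1/2})`. -/
def buresWassersteinSq {n : ℕ} (S S₀ : Matrix (Fin n) (Fin n) ℝ) : ℝ :=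
  Matrix.trace (S + S₀ - (2 : ℝ) • matSqrt (matSqrt S₀ * S * matSqrt S₀))

/-- The perturbative loss `L_τ` on covariance matrices: `S ↦ B²(S + τ I, S₀)`. -/
def covLoss {n : ℕ} (S₀ : Matrix (Fin n) (Fin n) ℝ) (τ : ℝ)
    (S : Matrix (Fin n) (Fin n) ℝ) : ℝ :=
  buresWassersteinSq (S + τ • (1 : Matrix (Fin n) (Fin n) ℝ)) S₀

/-- The perturbative loss `L¹_τ` on end-to-end matrices: `W ↦ L_τ (W Wᵀ)`. -/
def funcLoss {n m : ℕ} (S₀ : Matrix (Fin n) (Fin n) ℝ) (τ : ℝ)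
    (W : Matrix (Fin n) (Fin m) ℝ) : ℝ :=
  covLoss S₀ τ (W * Wᵀ)

/-! ### Deep linear networks -/

/-- Parameters of a linear network with `N` layers and widths `d 0, …, d N`. The index `j` is
zero-based: `θ j` is the weight matrix `W_{j+1}`, of size `d (j+1) × d j`. -/
abbrev Params (d : ℕ → ℕ) (N : ℕ) : Type :=
  (j : Fin N) → Matrix (Fin (d (j + 1))) (Fin (d j)) ℝ

/-- The weight matrix of the last layer. -/
def lastLayer {d : ℕ → ℕ} {N : ℕ} (θ : Params d (N + 1)) :
    Matrix (Fin (d (N + 1))) (Fin (d N)) ℝ :=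
  θ (Fin.last N)

/-- The parametrization map: the end-to-end matrix `W_N ⋯ W_1`. -/
def endToEnd (d : ℕ → ℕ) : (N : ℕ) → Params d N → Matrix (Fin (d N)) (Fin (d 0)) ℝ
  | 0, _ => 1
  | N + 1, θ => lastLayer θ * endToEnd d N (fun j => θ j.castSucc)

/-- The minimal width `min {d 0, …, d N}`. -/
def minWidth (d : ℕ → ℕ) (N : ℕ) : ℕ :=
  (Finset.range (N + 1)).inf' Finset.nonempty_range_add_one d

/-- The perturbative loss `L^N_τ` on the parameter space: `θ ↦ L¹_τ (W_N ⋯ W_1)`. -/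
def paramLoss (d : ℕ → ℕ) (N : ℕ) (S₀ : Matrix (Fin (d N)) (Fin (d N)) ℝ) (τ : ℝ)
    (θ : Params d N) : ℝ :=
  funcLoss S₀ τ (endToEnd d N θ)

/-! ### Critical points -/

/-- The set of real `n × m` matrices of rank exactly `k`. -/
def rankManifold (n m k : ℕ) : Set (Matrix (Fin n) (Fin m) ℝ) :=
  {W | W.rank = k}

/-- A critical point of `f`: `f` is differentiable at `x` with vanishing differential. -/
def IsCriticalPoint {E : Type*} [NormedAddCommGroup E] [NormedSpace ℝ E]
    (f : E → ℝ) (x : E) : Prop :=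
  HasFDerivAt f (0 : E →L[ℝ] ℝ) x

/-- The tangent space at `x` to an embedded submanifold `M` of a normed space: the set of the
velocities at time `0` of the smooth curves through `x` that stay in `M`. -/
def submanifoldTangent {E : Type*} [NormedAddCommGroup E] [NormedSpace ℝ E]
    (M : Set E) (x : E) : Set E :=
  {v | ∃ γ : ℝ → E, ContDiffAt ℝ ∞ γ 0 ∧ (∀ᶠ t in 𝓝 (0 : ℝ), γ t ∈ M) ∧
    γ 0 = x ∧ deriv γ 0 = v}

/-- `x` is a critical point of the restriction of `f` to the embedded submanifold `M`: the
restriction is differentiable and its differential vanishes on the tangent space at `x`.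
(On tangent vectors the value of a derivative within `M` does not depend on its choice.) -/
structure IsCriticalPointOn {E : Type*} [NormedAddCommGroup E] [NormedSpace ℝ E]
    (f : E → ℝ) (M : Set E) (x : E) : Prop where
  mem : x ∈ M
  differentiableOn : DifferentiableOn ℝ f M
  differential_eq_zero : ∀ v ∈ submanifoldTangent M x, fderivWithin ℝ f M x v = 0

end

-- Spaces of matrices carry the Frobenius norm.
attribute [local instance] Matrix.frobeniusNormedAddCommGroup Matrix.frobeniusNormedSpace

/-! The shift `τ > 0` keeps `S = W Wᵀ + τ I` positive definite, so the loss is differentiable at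
every `W`, with gradient `2 (1 - T) W`, where `T` is the optimal transport map from `S` to `Σ₀`, a
symmetric matrix with `T S T = Σ₀`.

Transfer between parameters and matrices rests on a local section of `μ` (`exists_local_section`).
Near `W = μ(θ)`, every matrix of rank at most `rank W` is `P W Q`, with `P` and `Q` differentiable
in that matrix and equal to `1` at `W`; the last layer absorbs `P` and the first absorbs `Q`.
Critical points and local minimizers thus descend to the matrices of fixed rank. Conversely, rank
cannot drop locally and never exceeds the minimal width, so near a parameter of maximal rank `μ`
takes values in that stratum, and local minimality lifts by continuity.

On a stratum, a local minimizer satisfies `T W = W`. With `K = W Wᵀ` the identity `T S T = Σ₀`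
becomes `Σ₀ = K + τ T²`, so `K` commutes with `Σ₀` and `K (K + τ I) = K Σ₀`. The spectrum of `Σ₀`
being simple, `K` is diagonal in the basis `Ω`, with entries `0` or `λ_i - τ`. A plane rotation
shows that the nonzero entries occupy the first `k` places, which fixes both `K` and the value of
the loss. Globality follows by comparison with a minimizer over the closed set of rank at most `k`:
it is a local minimizer on its own stratum, so the same formula gives its value. -/

/-! ### Square roots of positive semidefinite matrices and trace inequalities. -/

open scoped MatrixOrder in
theorem matSqrt_eq_sqrt {n : ℕ} {A : Matrix (Fin n) (Fin n) ℝ} (hA : A.PosSemidef) :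
    matSqrt A = CFC.sqrt A := by
  rw [CFC.sqrt_eq_real_sqrt A hA.nonneg, cfcₙ_eq_cfc (hf0 := by simp)]
  rfl

open scoped MatrixOrder in
theorem matSqrt_posSemidef {n : ℕ} {A : Matrix (Fin n) (Fin n) ℝ} (hA : A.PosSemidef) :
    (matSqrt A).PosSemidef := by
  rw [matSqrt_eq_sqrt hA]
  exact Matrix.nonneg_iff_posSemidef.1 (CFC.sqrt_nonneg A)

open scoped MatrixOrder in
theorem matSqrt_mul_self {n : ℕ} {A : Matrix (Fin n) (Fin n) ℝ} (hA : A.PosSemidef) :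
    matSqrt A * matSqrt A = A := by
  rw [matSqrt_eq_sqrt hA]
  exact CFC.sqrt_mul_sqrt_self A hA.nonneg

open scoped MatrixOrder in
theorem matSqrt_eq_of_mul_self {n : ℕ} {A B : Matrix (Fin n) (Fin n) ℝ} (hB : B.PosSemidef)
    (h : B * B = A) : matSqrt A = B := by
  have hA : A.PosSemidef := by
    rw [← h]
    nth_rewrite 1 [← hB.1]
    exact Matrix.posSemidef_conjTranspose_mul_self B
  rw [matSqrt_eq_sqrt hA]
  exact CFC.sqrt_unique h hB.nonneg

theorem matSqrt_posDef {n : ℕ} {A : Matrix (Fin n) (Fin n) ℝ} (hA : A.PosDef) :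
    (matSqrt A).PosDef := by
  have h := matSqrt_mul_self hA.posSemidef
  rw [(matSqrt_posSemidef hA.posSemidef).posDef_iff_isUnit]
  exact isUnit_of_mul_isUnit_left (h ▸ hA.isUnit)

theorem posSemidef_transpose_eq {n : ℕ} {A : Matrix (Fin n) (Fin n) ℝ} (hA : A.PosSemidef) :
    Aᵀ = A := by
  have := hA.1
  rwa [Matrix.IsHermitian, Matrix.conjTranspose_eq_transpose_of_trivial] at this

theorem posSemidef_trace_conj_nonneg {n m : ℕ} {A : Matrix (Fin n) (Fin n) ℝ}
    (hA : A.PosSemidef) (X : Matrix (Fin n) (Fin m) ℝ) : 0 ≤ (Xᵀ * A * X).trace := by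
  have := (hA.conjTranspose_mul_mul_same X).trace_nonneg
  rwa [Matrix.conjTranspose_eq_transpose_of_trivial] at this

theorem trace_transpose_mul_self_nonneg {n m : ℕ} (X : Matrix (Fin n) (Fin m) ℝ) :
    0 ≤ (Xᵀ * X).trace := by
  simpa using posSemidef_trace_conj_nonneg Matrix.PosSemidef.one X

theorem frobenius_norm_sq_eq_trace {n m : ℕ} (X : Matrix (Fin n) (Fin m) ℝ) :
    ‖X‖ ^ 2 = (Xᵀ * X).trace := by
  rw [Matrix.frobenius_norm_def, ← Real.sqrt_eq_rpow, Real.sq_sqrt (by positivity), Finset.sum_comm]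
  simp [Matrix.trace, Matrix.mul_apply, sq]

/-- Cauchy–Schwarz for the trace pairing: the polynomial `‖Xᵀ + t Y‖²` in `t` is nonnegative, so its
discriminant is nonpositive. -/
theorem abs_trace_mul_le {n m : ℕ} (X : Matrix (Fin n) (Fin m) ℝ) (Y : Matrix (Fin m) (Fin n) ℝ) :
    |(X * Y).trace| ≤ ‖X‖ * ‖Y‖ := by
  have h (t : ℝ) : 0 ≤ ‖Y‖ ^ 2 * (t * t) + (2 * (X * Y).trace) * t + ‖X‖ ^ 2 := by
    have := trace_transpose_mul_self_nonneg (Xᵀ + t • Y)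
    have e : (Yᵀ * Xᵀ).trace = (X * Y).trace := by
      rw [← Matrix.transpose_mul, Matrix.trace_transpose]
    have e' : (X * Xᵀ).trace = ‖X‖ ^ 2 := by
      rw [frobenius_norm_sq_eq_trace, Matrix.trace_mul_comm]
    simp only [Matrix.transpose_add, Matrix.transpose_transpose, Matrix.transpose_smul,
      Matrix.add_mul, Matrix.mul_add, Matrix.smul_mul, Matrix.mul_smul, Matrix.trace_add,
      Matrix.trace_smul, smul_eq_mul, e, e', ← frobenius_norm_sq_eq_trace] at this
    linarith
  have := discrim_le_zero h
  rw [discrim] at this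
  refine abs_le_of_sq_le_sq ?_ (by positivity)
  nlinarith

theorem exists_pos_mul_norm_sq_le_trace {n : ℕ} {A : Matrix (Fin n) (Fin n) ℝ} (hA : A.PosDef) :
    ∃ c : ℝ, 0 < c ∧ ∀ m, ∀ X : Matrix (Fin n) (Fin m) ℝ, c * ‖X‖ ^ 2 ≤ (Xᵀ * A * X).trace := by
  have hS := matSqrt_posDef hA
  set S := matSqrt A
  have h1 : S⁻¹ * S = 1 := Matrix.nonsing_inv_mul _ ((Matrix.isUnit_iff_isUnit_det _).1 hS.isUnit)
  -- The trace is `‖S X‖²`, and `‖X‖ ≤ ‖S⁻¹‖ ‖S X‖`. The summand `1` keeps the denominator positive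
  -- when `n = 0`.
  refine ⟨1 / (1 + ‖S⁻¹‖ ^ 2), by positivity, fun m X => ?_⟩
  have h2 : (Xᵀ * A * X).trace = ‖S * X‖ ^ 2 := by
    rw [frobenius_norm_sq_eq_trace, Matrix.transpose_mul, posSemidef_transpose_eq hS.posSemidef,
      ← matSqrt_mul_self hA.posSemidef]
    simp only [Matrix.mul_assoc]
    rfl
  have h3 : ‖X‖ ≤ ‖S⁻¹‖ * ‖S * X‖ := by
    calc ‖X‖ = ‖S⁻¹ * (S * X)‖ := by rw [← Matrix.mul_assoc, h1, Matrix.one_mul]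
      _ ≤ _ := Matrix.frobenius_norm_mul _ _
  rw [h2, div_mul_eq_mul_div, one_mul, div_le_iff₀ (by positivity)]
  calc ‖X‖ ^ 2 ≤ (‖S⁻¹‖ * ‖S * X‖) ^ 2 := by gcongr
    _ ≤ _ := by rw [mul_pow]; nlinarith [sq_nonneg ‖S * X‖]

/-- Local Lipschitz continuity of the square root at a positive definite matrix. -/
theorem matSqrt_sub_norm_le {n : ℕ} {A : Matrix (Fin n) (Fin n) ℝ} (hA : A.PosDef) :
    ∃ C : ℝ, 0 ≤ C ∧ ∀ B : Matrix (Fin n) (Fin n) ℝ, B.PosSemidef →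
      ‖matSqrt B - matSqrt A‖ ≤ C * ‖B - A‖ := by
  obtain ⟨c, hc, h⟩ := exists_pos_mul_norm_sq_le_trace (matSqrt_posDef hA)
  refine ⟨1 / c, by positivity, fun B hB => ?_⟩
  have hA' := matSqrt_mul_self hA.posSemidef
  have hB' := matSqrt_mul_self hB
  have hBp := matSqrt_posSemidef hB
  set R := matSqrt A
  set Q := matSqrt B
  set X := Q - R with hX
  -- Paired with `X`, the term in `Q` is nonnegative and can be dropped, while the term in `R`
  -- controls `‖X‖²`; hence `B` need only be semidefinite.
  have e : B - A = R * X + X * Q := by rw [← hA', ← hB', hX]; noncomm_ring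
  have h1 := h n X
  have h2 : 0 ≤ (Xᵀ * (X * Q)).trace := by
    rw [Matrix.trace_mul_comm]
    have := posSemidef_trace_conj_nonneg hBp Xᵀ
    rwa [Matrix.transpose_transpose] at this
  have h3 : c * ‖X‖ ^ 2 ≤ ‖X‖ * ‖B - A‖ := by
    calc c * ‖X‖ ^ 2 ≤ (Xᵀ * (B - A)).trace := by
          rw [e, Matrix.mul_add, Matrix.trace_add, ← Matrix.mul_assoc]; linarith
      _ ≤ ‖Xᵀ‖ * ‖B - A‖ := (le_abs_self _).trans (abs_trace_mul_le _ _)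
      _ = _ := by rw [Matrix.frobenius_norm_transpose]
  rw [div_mul_eq_mul_div, one_mul, le_div_iff₀ hc]
  rcases (norm_nonneg X).eq_or_lt with h0 | h0
  · rw [← h0, zero_mul]; positivity
  · nlinarith

/-- First order expansion of the trace of the square root at a positive definite matrix. -/
theorem trace_matSqrt_sub_le {n : ℕ} {A : Matrix (Fin n) (Fin n) ℝ} (hA : A.PosDef) :
    ∃ C : ℝ, 0 ≤ C ∧ ∀ B : Matrix (Fin n) (Fin n) ℝ, B.PosSemidef →
      |(matSqrt B).trace - (matSqrt A).trace - 1 / 2 * ((matSqrt A)⁻¹ * (B - A)).trace| ≤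
        C * ‖B - A‖ ^ 2 := by
  obtain ⟨C, hC, h⟩ := matSqrt_sub_norm_le hA
  refine ⟨1 / 2 * (‖(matSqrt A)⁻¹‖ * C ^ 2), by positivity, fun B hB => ?_⟩
  have hA' := matSqrt_mul_self hA.posSemidef
  have hB' := matSqrt_mul_self hB
  have hR := matSqrt_posDef hA
  have hle := h B hB
  set R := matSqrt A
  set Q := matSqrt B
  have h1 : R⁻¹ * R = 1 := Matrix.nonsing_inv_mul _ ((Matrix.isUnit_iff_isUnit_det _).1 hR.isUnit)
  have h2 : R * R⁻¹ = 1 := Matrix.mul_nonsing_inv _ ((Matrix.isUnit_iff_isUnit_det _).1 hR.isUnit)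
  set X := Q - R with hX
  -- Against `R⁻¹` each linear term has trace `tr X`, which leaves only a remainder quadratic in
  -- `X`.
  have e : B - A = R * X + X * R + X * X := by rw [← hA', ← hB', hX]; noncomm_ring
  have e1 : (R⁻¹ * (B - A)).trace = 2 * (Q.trace - R.trace) + (R⁻¹ * (X * X)).trace := by
    rw [← Matrix.trace_sub, ← hX, e, Matrix.mul_add, Matrix.mul_add, ← Matrix.mul_assoc, h1,
      Matrix.one_mul, Matrix.trace_add, Matrix.trace_add, ← Matrix.mul_assoc R⁻¹ X R,
      Matrix.trace_mul_comm _ R, ← Matrix.mul_assoc, h2, Matrix.one_mul]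
    ring
  have e2 : Q.trace - R.trace - 1 / 2 * (R⁻¹ * (B - A)).trace
      = -(1 / 2 * (R⁻¹ * (X * X)).trace) := by rw [e1]; ring
  rw [e2, abs_neg, abs_mul, abs_of_pos (by norm_num : (0 : ℝ) < 1 / 2)]
  calc 1 / 2 * |(R⁻¹ * (X * X)).trace| ≤ 1 / 2 * (‖R⁻¹‖ * (‖X‖ * ‖X‖)) := by
        gcongr
        exact (abs_trace_mul_le _ _).trans (by gcongr; exact Matrix.frobenius_norm_mul _ _)
    _ ≤ 1 / 2 * (‖R⁻¹‖ * ((C * ‖B - A‖) * (C * ‖B - A‖))) := by gcongr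
    _ = _ := by ring

/-! ### The fidelity and its first order expansion -/

/-- The symmetrized product `S₀^{1/2} S S₀^{1/2}`. -/
noncomputable def sandwich {n : ℕ} (S₀ S : Matrix (Fin n) (Fin n) ℝ) : Matrix (Fin n) (Fin n) ℝ :=
  matSqrt S₀ * S * matSqrt S₀

/-- The optimal transport map `S₀^{1/2} (S₀^{1/2} S S₀^{1/2})^{-1/2} S₀^{1/2}`. -/
noncomputable def transportMap {n : ℕ} (S₀ S : Matrix (Fin n) (Fin n) ℝ) : Matrix (Fin n) (Fin n) ℝ :=
  matSqrt S₀ * (matSqrt (sandwich S₀ S))⁻¹ * matSqrt S₀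

section

variable {n : ℕ} {S₀ S : Matrix (Fin n) (Fin n) ℝ}

theorem buresWassersteinSq_eq :
    buresWassersteinSq S S₀ = S.trace + S₀.trace - 2 * (matSqrt (sandwich S₀ S)).trace := by
  simp [buresWassersteinSq, sandwich, Matrix.trace_sub, Matrix.trace_add, Matrix.trace_smul]

theorem Matrix.PosDef.nonsing_inv_mul_self {A : Matrix (Fin n) (Fin n) ℝ} (hA : A.PosDef) :
    A⁻¹ * A = 1 :=
  Matrix.nonsing_inv_mul _ ((Matrix.isUnit_iff_isUnit_det _).1 hA.isUnit)

theorem Matrix.PosDef.self_mul_nonsing_inv {A : Matrix (Fin n) (Fin n) ℝ} (hA : A.PosDef) :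
    A * A⁻¹ = 1 :=
  Matrix.mul_nonsing_inv _ ((Matrix.isUnit_iff_isUnit_det _).1 hA.isUnit)

theorem sandwich_posDef (h₀ : S₀.PosDef) (h : S.PosDef) : (sandwich S₀ S).PosDef := by
  have hs := matSqrt_posDef h₀
  have := h.conjTranspose_mul_mul_same (B := matSqrt S₀)
    (Matrix.mulVec_injective_of_isUnit hs.isUnit)
  rwa [hs.1] at this

theorem transportMap_transpose (h₀ : S₀.PosDef) (h : S.PosDef) :
    (transportMap S₀ S)ᵀ = transportMap S₀ S := by
  rw [transportMap, Matrix.transpose_mul, Matrix.transpose_mul, Matrix.transpose_nonsing_inv,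
    posSemidef_transpose_eq (matSqrt_posDef h₀).posSemidef,
    posSemidef_transpose_eq (matSqrt_posDef (sandwich_posDef h₀ h)).posSemidef, Matrix.mul_assoc]

/-- The push-forward identity: the linear map `T` carries covariance `S` to covariance `S₀`. -/
theorem transportMap_mul_mul (h₀ : S₀.PosDef) (h : S.PosDef) :
    transportMap S₀ S * S * transportMap S₀ S = S₀ := by
  have hR := matSqrt_posDef (sandwich_posDef h₀ h)
  have hR2 := matSqrt_mul_self (sandwich_posDef h₀ h).posSemidef
  rw [transportMap]
  set R := matSqrt (sandwich S₀ S)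
  calc matSqrt S₀ * R⁻¹ * matSqrt S₀ * S * (matSqrt S₀ * R⁻¹ * matSqrt S₀)
      = matSqrt S₀ * R⁻¹ * (sandwich S₀ S) * (R⁻¹ * matSqrt S₀) := by
        simp only [sandwich, Matrix.mul_assoc]
    _ = matSqrt S₀ * (R⁻¹ * R) * (R * R⁻¹) * matSqrt S₀ := by
        rw [← hR2]; simp only [Matrix.mul_assoc]
    _ = S₀ := by
        rw [hR.nonsing_inv_mul_self, hR.self_mul_nonsing_inv, Matrix.mul_one, Matrix.mul_one,
          matSqrt_mul_self h₀.posSemidef]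

/-- The fidelity dominates `tr (S₀^{1/2} A)` for every factor `A` of `S`. -/
theorem trace_mul_le_trace_matSqrt_sandwich (h₀ : S₀.PosDef) (h : S.PosDef)
    {A : Matrix (Fin n) (Fin n) ℝ} (hA : A * Aᵀ = S) :
    (matSqrt S₀ * A).trace ≤ (matSqrt (sandwich S₀ S)).trace := by
  have hR := matSqrt_posDef (sandwich_posDef h₀ h)
  have hR2 := matSqrt_mul_self (sandwich_posDef h₀ h).posSemidef
  have hT := posSemidef_transpose_eq (matSqrt_posDef h₀).posSemidef
  have hRT := posSemidef_transpose_eq hR.posSemidef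
  set R := matSqrt (sandwich S₀ S)
  set M := matSqrt S₀ * A with hM
  have hMM : M * Mᵀ = R * R := by
    rw [hR2, hM, Matrix.transpose_mul, hT, sandwich, ← hA]; simp only [Matrix.mul_assoc]
  have hMR : R * (R⁻¹ * M) = M := by
    rw [← Matrix.mul_assoc, hR.self_mul_nonsing_inv, Matrix.one_mul]
  have h1 : (R⁻¹ * M) * (R⁻¹ * M)ᵀ = 1 := by
    rw [Matrix.transpose_mul, Matrix.transpose_nonsing_inv, hRT]
    calc R⁻¹ * M * (Mᵀ * R⁻¹) = R⁻¹ * (M * Mᵀ) * R⁻¹ := by simp only [Matrix.mul_assoc]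
      _ = (R⁻¹ * R) * (R * R⁻¹) := by rw [hMM]; simp only [Matrix.mul_assoc]
      _ = 1 := by rw [hR.nonsing_inv_mul_self, hR.self_mul_nonsing_inv, Matrix.one_mul]
  set U := R⁻¹ * M
  -- `M = R * U` is a polar decomposition with `U` orthogonal, and this trace expands to `2 tr R - 2
  -- tr M`.
  have h2 := posSemidef_trace_conj_nonneg hR.posSemidef (1 - U)
  have e : (1 - U)ᵀ * R * (1 - U) = R - R * U - Uᵀ * R + Uᵀ * (R * U) := by
    rw [Matrix.transpose_sub, Matrix.transpose_one]; noncomm_ring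
  have e1 : (Uᵀ * R).trace = M.trace := by
    rw [← hMR, ← Matrix.trace_transpose, Matrix.transpose_mul, Matrix.transpose_transpose, hRT]
  have e2 : (Uᵀ * (R * U)).trace = R.trace := by
    rw [Matrix.trace_mul_comm, Matrix.mul_assoc, h1, Matrix.mul_one]
  rw [e, Matrix.trace_add, Matrix.trace_sub, Matrix.trace_sub, e1, e2, hMR] at h2
  linarith

/-- Coercivity of the squared Bures-Wasserstein distance. -/
theorem le_buresWassersteinSq (h₀ : S₀.PosDef) (h : S.PosDef) :
    1 / 2 * S.trace - S₀.trace ≤ buresWassersteinSq S S₀ := by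
  have hR := matSqrt_posDef (sandwich_posDef h₀ h)
  have hR2 := matSqrt_mul_self (sandwich_posDef h₀ h).posSemidef
  have hT := posSemidef_transpose_eq (matSqrt_posDef h₀).posSemidef
  have hRT := posSemidef_transpose_eq hR.posSemidef
  have hTST := transportMap_mul_mul h₀ h
  have hTT := transportMap_transpose h₀ h
  -- The trace of `T S` is the fidelity and that of `T S T` is `tr S₀`, so this reads `tr S - 4 tr
  -- (T S) + 4 tr S₀ ≥ 0`, which is twice the claim.
  have h3 := posSemidef_trace_conj_nonneg h.posSemidef (1 - (2 : ℝ) • transportMap S₀ S)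
  rw [buresWassersteinSq_eq]
  have e1 : (transportMap S₀ S * S).trace = (matSqrt (sandwich S₀ S)).trace := by
    rw [transportMap, Matrix.mul_assoc, Matrix.mul_assoc, Matrix.trace_mul_comm, Matrix.mul_assoc,
      ← sandwich]
    nth_rewrite 2 [← hR2]
    rw [← Matrix.mul_assoc, hR.nonsing_inv_mul_self, Matrix.one_mul]
  have e2 : (S * transportMap S₀ S).trace = (matSqrt (sandwich S₀ S)).trace := by
    rw [Matrix.trace_mul_comm, e1]
  simp only [Matrix.transpose_sub, Matrix.transpose_one, Matrix.transpose_smul, hTT,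
    Matrix.sub_mul, Matrix.mul_sub, Matrix.one_mul, Matrix.mul_one, Matrix.smul_mul,
    Matrix.mul_smul, hTST, Matrix.trace_sub, Matrix.trace_smul, e1, e2, smul_eq_mul] at h3
  linarith

end

/-! ### First variation of the loss on end-to-end matrices. -/

section

variable {n m : ℕ} {S₀ : Matrix (Fin n) (Fin n) ℝ} {τ : ℝ}

theorem mul_transpose_add_smul_posDef (hτ : 0 < τ) (W : Matrix (Fin n) (Fin m) ℝ) :
    (W * Wᵀ + τ • (1 : Matrix (Fin n) (Fin n) ℝ)).PosDef := by
  have h1 := Matrix.posSemidef_self_mul_conjTranspose W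
  rw [Matrix.conjTranspose_eq_transpose_of_trivial] at h1
  exact Matrix.PosDef.posSemidef_add h1 (Matrix.PosDef.one.smul hτ)

theorem hasFDerivAt_of_abs_sub_le {E : Type*} [NormedAddCommGroup E] [NormedSpace ℝ E]
    {f : E → ℝ} {L : E →L[ℝ] ℝ} {x : E} {C : ℝ}
    (h : ∀ v, ‖v‖ ≤ 1 → |f (x + v) - f x - L v| ≤ C * ‖v‖ ^ 2) : HasFDerivAt f L x := by
  have h1 : (fun v => f (x + v) - f x - L v) =O[𝓝 0] fun v : E => ‖v‖ ^ 2 := by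
    refine Asymptotics.IsBigO.of_bound C ?_
    filter_upwards [Metric.closedBall_mem_nhds (0 : E) one_pos] with v hv
    rw [Real.norm_eq_abs, Real.norm_eq_abs, abs_of_nonneg (sq_nonneg ‖v‖)]
    exact h v (by simpa using hv)
  rw [hasFDerivAt_iff_isLittleO_nhds_zero]
  exact h1.trans_isLittleO (Asymptotics.isLittleO_norm_pow_id one_lt_two)

/-- First order expansion of the loss on end-to-end matrices. -/
theorem funcLoss_expansion (h₀ : S₀.PosDef) (hτ : 0 < τ) (W : Matrix (Fin n) (Fin m) ℝ) :
    ∃ C : ℝ, ∀ V : Matrix (Fin n) (Fin m) ℝ, ‖V‖ ≤ 1 →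
      |funcLoss S₀ τ (W + V) - funcLoss S₀ τ W -
        2 * (Wᵀ * (1 - transportMap S₀ (W * Wᵀ + τ • 1)) * V).trace| ≤ C * ‖V‖ ^ 2 := by
  have hS := mul_transpose_add_smul_posDef hτ W
  obtain ⟨C, hC, h⟩ := trace_matSqrt_sub_le (sandwich_posDef h₀ hS)
  set S := W * Wᵀ + τ • (1 : Matrix (Fin n) (Fin n) ℝ) with hSdef
  have hTT := transportMap_transpose h₀ hS
  set T := transportMap S₀ S with hT
  set H := matSqrt S₀ with hH
  -- The first summand bounds the term `(1 - T) V Vᵀ`; the second is the remainder of the square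
  -- root, since the sandwiched covariance moves by at most `‖H‖ (2‖W‖ + 1) ‖H‖ ‖V‖` for `‖V‖ ≤ 1`.
  refine ⟨‖1 - T‖ + 2 * (C * (‖H‖ * (2 * ‖W‖ + 1) * ‖H‖) ^ 2), fun V hV => ?_⟩
  have hS' := mul_transpose_add_smul_posDef hτ (W + V)
  have h' := h _ (sandwich_posDef h₀ hS').posSemidef
  rw [funcLoss, funcLoss, covLoss, covLoss, buresWassersteinSq_eq, buresWassersteinSq_eq]
  set S' := (W + V) * (W + V)ᵀ + τ • (1 : Matrix (Fin n) (Fin n) ℝ) with hSdef'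
  set F' := (matSqrt (sandwich S₀ S')).trace
  set F := (matSqrt (sandwich S₀ S)).trace
  have e0 : S' - S = W * Vᵀ + V * Wᵀ + V * Vᵀ := by
    rw [hSdef, hSdef', Matrix.transpose_add, Matrix.add_mul, Matrix.mul_add, Matrix.mul_add]
    abel
  have e1 : sandwich S₀ S' - sandwich S₀ S = H * (S' - S) * H := by
    rw [sandwich, sandwich]; noncomm_ring
  have e2 : ((matSqrt (sandwich S₀ S))⁻¹ * (H * (S' - S) * H)).trace = (T * (S' - S)).trace := by
    rw [← Matrix.mul_assoc, Matrix.trace_mul_comm, hT, transportMap, ← hH]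
    simp only [Matrix.mul_assoc]
  have e3 : ((1 - T) * (W * Vᵀ)).trace = (Wᵀ * (1 - T) * V).trace := by
    rw [← Matrix.trace_transpose, Matrix.transpose_mul, Matrix.transpose_mul,
      Matrix.transpose_transpose, Matrix.transpose_sub, Matrix.transpose_one, hTT,
      Matrix.mul_assoc, Matrix.trace_mul_comm]
  have e4 : ((1 - T) * (V * Wᵀ)).trace = (Wᵀ * (1 - T) * V).trace := by
    rw [← Matrix.mul_assoc, Matrix.trace_mul_comm, ← Matrix.mul_assoc]
  have e5 : S'.trace - S.trace - (T * (S' - S)).trace =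
      2 * (Wᵀ * (1 - T) * V).trace + ((1 - T) * (V * Vᵀ)).trace := by
    rw [← Matrix.trace_sub, ← Matrix.trace_sub]
    have : S' - S - T * (S' - S) = (1 - T) * (S' - S) := by noncomm_ring
    rw [this, e0, Matrix.mul_add, Matrix.mul_add, Matrix.trace_add, Matrix.trace_add, e3, e4]
    ring
  rw [e1, e2] at h'
  have n1 : ‖S' - S‖ ≤ (2 * ‖W‖ + 1) * ‖V‖ := by
    rw [e0]
    calc _ ≤ ‖W * Vᵀ‖ + ‖V * Wᵀ‖ + ‖V * Vᵀ‖ := norm_add₃_le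
      _ ≤ ‖W‖ * ‖V‖ + ‖V‖ * ‖W‖ + ‖V‖ * ‖V‖ := by
        gcongr <;> exact (Matrix.frobenius_norm_mul _ _).trans_eq
          (by rw [Matrix.frobenius_norm_transpose])
      _ ≤ _ := by nlinarith [norm_nonneg V]
  have n2 : ‖H * (S' - S) * H‖ ≤ ‖H‖ * (2 * ‖W‖ + 1) * ‖H‖ * ‖V‖ := by
    calc _ ≤ ‖H‖ * ‖S' - S‖ * ‖H‖ := (Matrix.frobenius_norm_mul _ _).trans
          (by gcongr; exact Matrix.frobenius_norm_mul _ _)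
      _ ≤ ‖H‖ * ((2 * ‖W‖ + 1) * ‖V‖) * ‖H‖ := by gcongr
      _ = _ := by ring
  have n3 : |((1 - T) * (V * Vᵀ)).trace| ≤ ‖1 - T‖ * ‖V‖ ^ 2 := by
    refine (abs_trace_mul_le _ _).trans ?_
    gcongr
    exact (Matrix.frobenius_norm_mul _ _).trans_eq (by rw [Matrix.frobenius_norm_transpose, sq])
  have n4 : |F' - F - 1 / 2 * (T * (S' - S)).trace| ≤
      C * (‖H‖ * (2 * ‖W‖ + 1) * ‖H‖) ^ 2 * ‖V‖ ^ 2 := by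
    refine h'.trans ?_
    rw [mul_assoc C, ← mul_pow]
    gcongr
  have key : S'.trace + S₀.trace - 2 * F' - (S.trace + S₀.trace - 2 * F) -
      2 * (Wᵀ * (1 - T) * V).trace = ((1 - T) * (V * Vᵀ)).trace -
        2 * (F' - F - 1 / 2 * (T * (S' - S)).trace) := by linarith
  rw [key]
  calc _ ≤ |((1 - T) * (V * Vᵀ)).trace| + 2 * |F' - F - 1 / 2 * (T * (S' - S)).trace| := by
        refine (abs_sub _ _).trans_eq ?_
        rw [abs_mul, abs_two]
    _ ≤ _ := by linarith

theorem funcLoss_hasFDerivAt (h₀ : S₀.PosDef) (hτ : 0 < τ) (W : Matrix (Fin n) (Fin m) ℝ) :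
    ∃ L : Matrix (Fin n) (Fin m) ℝ →L[ℝ] ℝ, HasFDerivAt (funcLoss S₀ τ) L W ∧
      ∀ V, L V = 2 * (Wᵀ * (1 - transportMap S₀ (W * Wᵀ + τ • 1)) * V).trace := by
  obtain ⟨C, hC⟩ := funcLoss_expansion h₀ hτ W
  let L₀ : Matrix (Fin n) (Fin m) ℝ →ₗ[ℝ] ℝ :=
    { toFun := fun V => 2 * (Wᵀ * (1 - transportMap S₀ (W * Wᵀ + τ • 1)) * V).trace
      map_add' := fun V V' => by rw [Matrix.mul_add, Matrix.trace_add, mul_add]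
      map_smul' := fun c V => by
        rw [Matrix.mul_smul, Matrix.trace_smul, smul_eq_mul, RingHom.id_apply, smul_eq_mul]; ring }
  let L : Matrix (Fin n) (Fin m) ℝ →L[ℝ] ℝ := LinearMap.toContinuousLinearMap L₀
  refine ⟨L, ?_, fun V => rfl⟩
  exact hasFDerivAt_of_abs_sub_le (E := Matrix (Fin n) (Fin m) ℝ) (C := C) hC

end

/-! ### Matrix-valued differentiable functions -/

section

variable {E : Type} [NormedAddCommGroup E] [NormedSpace ℝ E] {l m n : ℕ} {x : E}

theorem differentiableAt_matrix_iff {A : E → Matrix (Fin n) (Fin m) ℝ} :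
    DifferentiableAt ℝ A x ↔ ∀ i j, DifferentiableAt ℝ (fun y => A y i j) x :=
  (differentiableAt_pi (E := E) (F' := fun _ : Fin n => Fin m → ℝ) (Φ := A)).trans
    (forall_congr' fun _ => differentiableAt_pi)

theorem DifferentiableAt.matrix_mul {A : E → Matrix (Fin l) (Fin m) ℝ}
    {B : E → Matrix (Fin m) (Fin n) ℝ} (hA : DifferentiableAt ℝ A x)
    (hB : DifferentiableAt ℝ B x) : DifferentiableAt ℝ (fun y => A y * B y) x := by
  rw [differentiableAt_matrix_iff] at hA hB ⊢
  intro i j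
  simp only [Matrix.mul_apply]
  exact DifferentiableAt.fun_sum fun k _ => (hA i k).mul (hB k j)

theorem DifferentiableAt.matrix_add {A B : E → Matrix (Fin n) (Fin m) ℝ}
    (hA : DifferentiableAt ℝ A x) (hB : DifferentiableAt ℝ B x) :
    DifferentiableAt ℝ (fun y => A y + B y) x := by
  rw [differentiableAt_matrix_iff] at hA hB ⊢
  exact fun i j => (hA i j).add (hB i j)

theorem DifferentiableAt.matrix_sub {A B : E → Matrix (Fin n) (Fin m) ℝ}
    (hA : DifferentiableAt ℝ A x) (hB : DifferentiableAt ℝ B x) :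
    DifferentiableAt ℝ (fun y => A y - B y) x := by
  rw [differentiableAt_matrix_iff] at hA hB ⊢
  exact fun i j => (hA i j).sub (hB i j)

theorem differentiableAt_matrix_const (A : Matrix (Fin n) (Fin m) ℝ) :
    DifferentiableAt ℝ (fun _ : E => A) x :=
  differentiableAt_matrix_iff.2 fun _ _ => differentiableAt_const _

theorem differentiableAt_matrix_id {A : Matrix (Fin n) (Fin m) ℝ} :
    DifferentiableAt ℝ (fun B : Matrix (Fin n) (Fin m) ℝ => B) A := differentiableAt_id

theorem DifferentiableAt.matrix_det {A : E → Matrix (Fin n) (Fin n) ℝ}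
    (hA : DifferentiableAt ℝ A x) : DifferentiableAt ℝ (fun y => (A y).det) x := by
  rw [differentiableAt_matrix_iff] at hA
  simp only [Matrix.det_apply]
  exact DifferentiableAt.fun_sum fun σ _ =>
    (HasFDerivAt.finsetProd fun i _ => (hA (σ i) i).hasFDerivAt).differentiableAt.const_smul _

theorem DifferentiableAt.matrix_inv {A : E → Matrix (Fin n) (Fin n) ℝ}
    (hA : DifferentiableAt ℝ A x) (h : (A x).det ≠ 0) :
    DifferentiableAt ℝ (fun y => (A y)⁻¹) x := by
  rw [differentiableAt_matrix_iff]
  intro i j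
  simp only [Matrix.inv_def, Ring.inverse_eq_inv', Matrix.smul_apply, smul_eq_mul,
    Matrix.adjugate_apply]
  refine (hA.matrix_det.inv h).mul (DifferentiableAt.matrix_det ?_)
  rw [differentiableAt_matrix_iff] at hA ⊢
  intro a b
  simp only [Matrix.updateRow_apply]
  split_ifs
  · exact differentiableAt_const _
  · exact hA a b

end

/-! ### Rank factorizations -/

section

variable {n m : ℕ}

/-- The linear map factors through its range, identified with `ℝ^k`; injectivity and surjectivity of
the two factors give the one-sided inverses. -/
theorem Matrix.exists_rank_factorization {k : ℕ} (W : Matrix (Fin n) (Fin m) ℝ)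
    (h : W.rank = k) :
    ∃ (U : Matrix (Fin n) (Fin k) ℝ) (V : Matrix (Fin k) (Fin m) ℝ)
      (L : Matrix (Fin k) (Fin n) ℝ) (R : Matrix (Fin m) (Fin k) ℝ),
      W = U * V ∧ L * U = 1 ∧ V * R = 1 := by
  let f := W.mulVecLin
  let e : LinearMap.range f ≃ₗ[ℝ] (Fin k → ℝ) :=
    LinearEquiv.ofFinrankEq _ _ (by rw [Module.finrank_fin_fun]; exact h)
  let u : (Fin k → ℝ) →ₗ[ℝ] (Fin n → ℝ) := (LinearMap.range f).subtype ∘ₗ e.symm.toLinearMap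
  let v : (Fin m → ℝ) →ₗ[ℝ] (Fin k → ℝ) := e.toLinearMap ∘ₗ f.rangeRestrict
  obtain ⟨l, hl⟩ := u.exists_leftInverse_of_injective (LinearMap.ker_eq_bot.2
    ((LinearMap.range f).injective_subtype.comp e.symm.injective))
  obtain ⟨r, hr⟩ := v.exists_rightInverse_of_surjective (LinearMap.range_eq_top.2
    (e.surjective.comp f.surjective_rangeRestrict))
  refine ⟨LinearMap.toMatrix' u, LinearMap.toMatrix' v, LinearMap.toMatrix' l,
    LinearMap.toMatrix' r, ?_, ?_, ?_⟩
  · rw [← LinearMap.toMatrix'_comp]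
    have : u ∘ₗ v = f := by ext; simp [u, v]
    rw [this]
    exact (LinearMap.toMatrix'_toLin' W).symm
  · rw [← LinearMap.toMatrix'_comp, hl, LinearMap.toMatrix'_id]
  · rw [← LinearMap.toMatrix'_comp, hr, LinearMap.toMatrix'_id]

/-- The determinant condition is open in `W`, which makes the rank lower semicontinuous. -/
theorem Matrix.le_rank_of_det_ne_zero {k : ℕ} {W : Matrix (Fin n) (Fin m) ℝ}
    {L : Matrix (Fin k) (Fin n) ℝ} {R : Matrix (Fin m) (Fin k) ℝ} (h : (L * W * R).det ≠ 0) :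
    k ≤ W.rank := by
  have h1 := Matrix.rank_of_det_ne_zero h
  rw [Fintype.card_fin] at h1
  rw [← h1]
  exact (Matrix.rank_mul_le_left _ _).trans (Matrix.rank_mul_le_right _ _)

/-- A matrix of rank at most `k` is determined by an invertible `k × k` compression. -/
theorem Matrix.eq_mul_inv_mul_of_rank_le {k : ℕ} {W : Matrix (Fin n) (Fin m) ℝ}
    {L : Matrix (Fin k) (Fin n) ℝ} {R : Matrix (Fin m) (Fin k) ℝ} (h : (L * W * R).det ≠ 0)
    (hk : W.rank ≤ k) : W * R * (L * W * R)⁻¹ * (L * W) = W := by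
  obtain ⟨U, V, -, -, rfl, -, -⟩ :=
    W.exists_rank_factorization (hk.antisymm (Matrix.le_rank_of_det_ne_zero h))
  have e : L * (U * V) * R = (L * U) * (V * R) := by simp only [Matrix.mul_assoc]
  rw [e, Matrix.det_mul] at h
  rw [e, Matrix.mul_inv_rev]
  calc U * V * R * ((V * R)⁻¹ * (L * U)⁻¹) * (L * (U * V))
      = U * ((V * R) * (V * R)⁻¹) * ((L * U)⁻¹ * (L * U)) * V := by simp only [Matrix.mul_assoc]
    _ = U * V := by
      rw [Matrix.mul_nonsing_inv _ (right_ne_zero_of_mul h).isUnit,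
        Matrix.nonsing_inv_mul _ (left_ne_zero_of_mul h).isUnit, Matrix.mul_one, Matrix.mul_one]

/-- Near a matrix of rank `k`, every matrix of rank at most `k` is obtained from it by
differentiable left and right multiplications. -/
theorem Matrix.exists_local_orbit_section (W : Matrix (Fin n) (Fin m) ℝ) :
    ∃ (P : Matrix (Fin n) (Fin m) ℝ → Matrix (Fin n) (Fin n) ℝ)
      (Q : Matrix (Fin n) (Fin m) ℝ → Matrix (Fin m) (Fin m) ℝ),
      DifferentiableAt ℝ P W ∧ DifferentiableAt ℝ Q W ∧ P W = 1 ∧ Q W = 1 ∧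
      ∀ᶠ W' in 𝓝 W, W.rank ≤ W'.rank ∧ (W'.rank ≤ W.rank → P W' * W * Q W' = W') := by
  obtain ⟨k, hk⟩ : ∃ k, W.rank = k := ⟨_, rfl⟩
  obtain ⟨U, V, L, R, hW, hL, hR⟩ := W.exists_rank_factorization hk
  rw [hk]
  have hLR : L * W * R = 1 := by
    rw [hW, ← Matrix.mul_assoc, hL, Matrix.one_mul, hR]
  have hd : DifferentiableAt ℝ (fun W' : Matrix (Fin n) (Fin m) ℝ => L * W' * R) W :=
    ((differentiableAt_matrix_const L).matrix_mul differentiableAt_matrix_id).matrix_mul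
      (differentiableAt_matrix_const R)
  have hdet : (L * W * R).det ≠ 0 := by rw [hLR, Matrix.det_one]; exact one_ne_zero
  -- `P W'` sends `U` to `W' R (L W' R)⁻¹`, and `Q W'` turns `V` into `L W'`. The product of these
  -- two factors recovers `W'` when its rank is at most `k`.
  refine ⟨fun W' => 1 + (W' * R * (L * W' * R)⁻¹ - U) * L, fun W' => 1 + R * (L * W' - V),
    ?_, ?_, ?_, ?_, ?_⟩
  · exact (differentiableAt_matrix_const _).matrix_add ((((differentiableAt_matrix_id.matrix_mul
      (differentiableAt_matrix_const R)).matrix_mul (hd.matrix_inv hdet)).matrix_sub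
      (differentiableAt_matrix_const U)).matrix_mul (differentiableAt_matrix_const L))
  · exact (differentiableAt_matrix_const _).matrix_add ((differentiableAt_matrix_const R).matrix_mul
      (((differentiableAt_matrix_const L).matrix_mul differentiableAt_matrix_id).matrix_sub
      (differentiableAt_matrix_const V)))
  · have : W * R = U := by rw [hW, Matrix.mul_assoc, hR, Matrix.mul_one]
    simp only [hLR, this, inv_one, Matrix.mul_one, sub_self, Matrix.zero_mul, add_zero]
  · have : L * W = V := by rw [hW, ← Matrix.mul_assoc, hL, Matrix.one_mul]
    simp only [this, sub_self, Matrix.mul_zero, add_zero]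
  · have hev : ∀ᶠ W' in 𝓝 W, (L * W' * R).det ≠ 0 :=
      hd.matrix_det.continuousAt.eventually_ne hdet
    filter_upwards [hev] with W' h'
    refine ⟨Matrix.le_rank_of_det_ne_zero h', fun hr => ?_⟩
    calc (1 + (W' * R * (L * W' * R)⁻¹ - U) * L) * W * (1 + R * (L * W' - V))
        = (U + (W' * R * (L * W' * R)⁻¹ - U) * (L * U)) *
            (V + V * R * (L * W' - V)) := by
          conv_lhs => rw [hW]
          simp only [Matrix.add_mul, Matrix.mul_add, Matrix.one_mul, Matrix.mul_one,
            Matrix.mul_assoc]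
      _ = W' * R * (L * W' * R)⁻¹ * (L * W') := by
          rw [hL, hR, Matrix.mul_one, Matrix.one_mul, add_sub_cancel, add_sub_cancel]
      _ = W' := Matrix.eq_mul_inv_mul_of_rank_le h' hr

theorem Matrix.isClosed_rank_le (k : ℕ) :
    IsClosed {W : Matrix (Fin n) (Fin m) ℝ | W.rank ≤ k} := by
  rw [← isOpen_compl_iff, isOpen_iff_mem_nhds]
  intro W hW
  obtain ⟨_, _, _, _, _, _, h⟩ := W.exists_local_orbit_section
  filter_upwards [h] with W' hW'
  simp only [Set.mem_compl_iff, Set.mem_ofPred_eq, not_le] at hW ⊢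
  exact hW.trans_le hW'.1

end

/-! ### Deep linear networks -/

section

variable {d : ℕ → ℕ} {N : ℕ}

/-- The layers before the last one. -/
def initLayers (θ : Params d (N + 1)) : Params d N := fun j => θ j.castSucc

/-- The weight matrix of the first layer. -/
def firstLayer (θ : Params d (N + 1)) : Matrix (Fin (d 1)) (Fin (d 0)) ℝ := θ 0

/-- Replacement of the weight matrix of the first layer. -/
def updateFirst (θ : Params d (N + 1)) (A : Matrix (Fin (d 1)) (Fin (d 0)) ℝ) :
    Params d (N + 1) := Function.update θ 0 A

/-- Replacement of the weight matrix of the last layer. -/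
def updateLast (θ : Params d (N + 1)) (A : Matrix (Fin (d (N + 1))) (Fin (d N)) ℝ) :
    Params d (N + 1) := Function.update θ (Fin.last N) A

theorem updateFirst_zero (θ : Params d (N + 1)) (A : Matrix (Fin (d 1)) (Fin (d 0)) ℝ) :
    updateFirst θ A 0 = A := Function.update_self _ _ _

theorem updateFirst_of_ne (θ : Params d (N + 1)) (A : Matrix (Fin (d 1)) (Fin (d 0)) ℝ)
    {j : Fin (N + 1)} (hj : j ≠ 0) : updateFirst θ A j = θ j := Function.update_of_ne hj _ _

theorem updateFirst_firstLayer (θ : Params d (N + 1)) : updateFirst θ (firstLayer θ) = θ :=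
  Function.update_eq_self _ _

theorem updateLast_last (θ : Params d (N + 1)) (A : Matrix (Fin (d (N + 1))) (Fin (d N)) ℝ) :
    updateLast θ A (Fin.last N) = A := Function.update_self _ _ _

theorem updateLast_of_ne (θ : Params d (N + 1)) (A : Matrix (Fin (d (N + 1))) (Fin (d N)) ℝ)
    {j : Fin (N + 1)} (hj : j ≠ Fin.last N) : updateLast θ A j = θ j :=
  Function.update_of_ne hj _ _

theorem updateLast_lastLayer (θ : Params d (N + 1)) : updateLast θ (lastLayer θ) = θ :=
  Function.update_eq_self _ _

theorem endToEnd_succ (θ : Params d (N + 1)) :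
    endToEnd d (N + 1) θ = lastLayer θ * endToEnd d N (initLayers θ) := rfl

theorem endToEnd_mul_left (θ : Params d (N + 1))
    (P : Matrix (Fin (d (N + 1))) (Fin (d (N + 1))) ℝ) :
    endToEnd d (N + 1) (updateLast θ (P * lastLayer θ)) = P * endToEnd d (N + 1) θ := by
  have h1 : lastLayer (updateLast θ (P * lastLayer θ)) = P * lastLayer θ := updateLast_last _ _
  have h2 : initLayers (updateLast θ (P * lastLayer θ)) = initLayers θ :=
    funext fun j => updateLast_of_ne _ _ (Fin.castSucc_lt_last j).ne
  rw [endToEnd_succ, endToEnd_succ, h1, h2, Matrix.mul_assoc]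

theorem endToEnd_mul_right (θ : Params d (N + 1)) (Q : Matrix (Fin (d 0)) (Fin (d 0)) ℝ) :
    endToEnd d (N + 1) (updateFirst θ (firstLayer θ * Q)) = endToEnd d (N + 1) θ * Q := by
  induction N with
  | zero =>
    have h1 : lastLayer (updateFirst θ (firstLayer θ * Q)) = firstLayer θ * Q :=
      updateFirst_zero _ _
    rw [endToEnd_succ, endToEnd_succ, h1]
    exact (Matrix.mul_one _).trans (congrArg (· * Q) (Matrix.mul_one (firstLayer θ)).symm)
  | succ N ih =>
    have h1 : initLayers (updateFirst θ (firstLayer θ * Q)) =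
        updateFirst (initLayers θ) (firstLayer (initLayers θ) * Q) := by
      funext j
      rcases eq_or_ne j 0 with rfl | hj
      · rfl
      · exact (updateFirst_of_ne _ _ (Fin.castSucc_ne_zero_iff.2 hj)).trans
          (updateFirst_of_ne (initLayers θ) (firstLayer (initLayers θ) * Q) hj).symm
    have h2 : lastLayer (updateFirst θ (firstLayer θ * Q)) = lastLayer θ :=
      updateFirst_of_ne _ _ (Fin.last_pos).ne'
    rw [endToEnd_succ (N := N + 1), endToEnd_succ θ, h1, h2, ih, Matrix.mul_assoc]

theorem rank_endToEnd_le (θ : Params d N) {j : ℕ} (hj : j ≤ N) : (endToEnd d N θ).rank ≤ d j := by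
  induction N with
  | zero =>
    obtain rfl : j = 0 := by omega
    exact Matrix.rank_le_width _
  | succ N ih =>
    rcases hj.eq_or_lt with rfl | hj
    · exact Matrix.rank_le_height _
    · exact (Matrix.rank_mul_le_right _ _).trans (ih _ (by omega))

theorem rank_endToEnd_le_minWidth (θ : Params d N) : (endToEnd d N θ).rank ≤ minWidth d N :=
  Finset.le_inf' _ _ fun j hj => rank_endToEnd_le θ (by simpa [Nat.lt_succ_iff] using hj)

theorem differentiableAt_params_iff {E : Type} [NormedAddCommGroup E] [NormedSpace ℝ E] {x : E}
    {s : E → Params d N} :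
    DifferentiableAt ℝ s x ↔ ∀ j, DifferentiableAt ℝ (fun y => s y j) x :=
  differentiableAt_pi

theorem differentiable_endToEnd (d : ℕ → ℕ) (N : ℕ) : Differentiable ℝ (endToEnd d N) := by
  induction N with
  | zero => exact fun θ => differentiableAt_matrix_const _
  | succ N ih =>
    intro θ
    have h := differentiableAt_params_iff.1 (differentiableAt_id (𝕜 := ℝ) (x := θ))
    refine DifferentiableAt.matrix_mul (h (Fin.last N)) ?_
    have h' : DifferentiableAt ℝ (fun θ : Params d (N + 1) => initLayers θ) θ :=
      differentiableAt_params_iff.2 fun j => h j.castSucc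
    exact (ih _).comp θ h'

/-- A differentiable local section of the parametrization map over the matrices of rank at most
the rank of the given end-to-end matrix. -/
theorem exists_local_section (θ : Params d (N + 1)) :
    ∃ s : Matrix (Fin (d (N + 1))) (Fin (d 0)) ℝ → Params d (N + 1),
      DifferentiableAt ℝ s (endToEnd d (N + 1) θ) ∧ s (endToEnd d (N + 1) θ) = θ ∧
      ∀ᶠ W in 𝓝 (endToEnd d (N + 1) θ), W.rank ≤ (endToEnd d (N + 1) θ).rank →
        endToEnd d (N + 1) (s W) = W := by
  obtain ⟨P, Q, hP, hQ, hP1, hQ1, hev⟩ := (endToEnd d (N + 1) θ).exists_local_orbit_section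
  have ht : DifferentiableAt ℝ (fun W => updateLast θ (P W * lastLayer θ))
      (endToEnd d (N + 1) θ) := by
    refine differentiableAt_params_iff.2 fun j => ?_
    rcases eq_or_ne j (Fin.last N) with rfl | hj
    · simp only [updateLast_last]
      exact hP.matrix_mul (differentiableAt_matrix_const (lastLayer θ))
    · simp only [updateLast_of_ne _ _ hj]
      exact differentiableAt_matrix_const _
  have ht1 : updateLast θ (P (endToEnd d (N + 1) θ) * lastLayer θ) = θ := by
    rw [hP1, Matrix.one_mul, updateLast_lastLayer]
  generalize ht' : (fun W => updateLast θ (P W * lastLayer θ)) = t at ht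
  have ht2 W : updateLast θ (P W * lastLayer θ) = t W := congrFun ht' W
  rw [ht2] at ht1
  -- The first layer is read from `t W`, not from `θ`: with a single layer it is also the last one,
  -- and must carry both multipliers.
  refine ⟨fun W => updateFirst (t W) (firstLayer (t W) * Q W), ?_, ?_, ?_⟩
  · have hj' := differentiableAt_params_iff.1 ht
    refine differentiableAt_params_iff.2 fun j => ?_
    rcases eq_or_ne j 0 with rfl | hj
    · simp only [updateFirst_zero]
      exact DifferentiableAt.matrix_mul (hj' 0) hQ
    · simp only [updateFirst_of_ne _ _ hj]
      exact hj' j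
  · simp only [ht1, hQ1, Matrix.mul_one, updateFirst_firstLayer]
  · filter_upwards [hev] with W hW hr
    rw [endToEnd_mul_right, ← ht2, endToEnd_mul_left, hW.2 hr]

end

/-! ### Matrices diagonal in a fixed orthonormal basis -/

/-- The matrix `Om diag(a) Omᵀ`. -/
def conjDiag {n : ℕ} (Om : Matrix (Fin n) (Fin n) ℝ) (a : Fin n → ℝ) :
    Matrix (Fin n) (Fin n) ℝ := Om * Matrix.diagonal a * Omᵀ

section

variable {n : ℕ} {Om : Matrix (Fin n) (Fin n) ℝ}

theorem transpose_mul_self_of_mem (hOm : Om ∈ Matrix.orthogonalGroup (Fin n) ℝ) : Omᵀ * Om = 1 :=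
  (Matrix.mem_orthogonalGroup_iff' _ _).1 hOm

theorem self_mul_transpose_of_mem (hOm : Om ∈ Matrix.orthogonalGroup (Fin n) ℝ) : Om * Omᵀ = 1 :=
  (Matrix.mem_orthogonalGroup_iff _ _).1 hOm

theorem conj_mul_conj (hOm : Om ∈ Matrix.orthogonalGroup (Fin n) ℝ)
    (A B : Matrix (Fin n) (Fin n) ℝ) : Om * A * Omᵀ * (Om * B * Omᵀ) = Om * (A * B) * Omᵀ := by
  calc Om * A * Omᵀ * (Om * B * Omᵀ) = Om * A * (Omᵀ * Om) * B * Omᵀ := by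
        simp only [Matrix.mul_assoc]
    _ = _ := by rw [transpose_mul_self_of_mem hOm, Matrix.mul_one, Matrix.mul_assoc Om]

theorem trace_conj (hOm : Om ∈ Matrix.orthogonalGroup (Fin n) ℝ)
    (A : Matrix (Fin n) (Fin n) ℝ) : (Om * A * Omᵀ).trace = A.trace := by
  rw [Matrix.trace_mul_comm, ← Matrix.mul_assoc, transpose_mul_self_of_mem hOm, Matrix.one_mul]

theorem eq_of_conj_eq (hOm : Om ∈ Matrix.orthogonalGroup (Fin n) ℝ)
    {A B : Matrix (Fin n) (Fin n) ℝ} (h : Om * A * Omᵀ = Om * B * Omᵀ) : A = B := by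
  have key (C : Matrix (Fin n) (Fin n) ℝ) : Omᵀ * (Om * C * Omᵀ) * Om = C := by
    calc Omᵀ * (Om * C * Omᵀ) * Om = (Omᵀ * Om) * C * (Omᵀ * Om) := by
          simp only [Matrix.mul_assoc]
      _ = C := by rw [transpose_mul_self_of_mem hOm, Matrix.one_mul, Matrix.mul_one]
  rw [← key A, h, key B]

theorem conjDiag_mul (hOm : Om ∈ Matrix.orthogonalGroup (Fin n) ℝ) (a b : Fin n → ℝ) :
    conjDiag Om a * conjDiag Om b = conjDiag Om (fun i => a i * b i) := by
  rw [conjDiag, conjDiag, conj_mul_conj hOm, Matrix.diagonal_mul_diagonal, conjDiag]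

theorem conjDiag_add_smul_one (hOm : Om ∈ Matrix.orthogonalGroup (Fin n) ℝ) (a : Fin n → ℝ)
    (τ : ℝ) : conjDiag Om a + τ • (1 : Matrix (Fin n) (Fin n) ℝ) =
      conjDiag Om (fun i => a i + τ) := by
  have h : Matrix.diagonal (fun i => a i + τ) =
      Matrix.diagonal a + τ • (1 : Matrix (Fin n) (Fin n) ℝ) := by
    rw [Matrix.smul_one_eq_diagonal, Matrix.diagonal_add]
  rw [conjDiag, conjDiag, h, Matrix.mul_add, Matrix.add_mul, Matrix.mul_smul, Matrix.mul_one,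
    Matrix.smul_mul, self_mul_transpose_of_mem hOm]

theorem conjDiag_posSemidef {a : Fin n → ℝ} (ha : ∀ i, 0 ≤ a i) : (conjDiag Om a).PosSemidef := by
  have := (Matrix.PosSemidef.diagonal ha).mul_mul_conjTranspose_same Om
  rwa [Matrix.conjTranspose_eq_transpose_of_trivial] at this

theorem conjDiag_posDef (hOm : Om ∈ Matrix.orthogonalGroup (Fin n) ℝ) {a : Fin n → ℝ}
    (ha : ∀ i, 0 < a i) : (conjDiag Om a).PosDef := by
  rw [(conjDiag_posSemidef fun i => (ha i).le).posDef_iff_isUnit]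
  refine IsUnit.of_mul_eq_one (conjDiag Om fun i => (a i)⁻¹) ?_
  rw [conjDiag_mul hOm]
  simp only [fun i => mul_inv_cancel₀ (ha i).ne']
  rw [conjDiag, Matrix.diagonal_one, Matrix.mul_one, self_mul_transpose_of_mem hOm]

theorem matSqrt_conjDiag (hOm : Om ∈ Matrix.orthogonalGroup (Fin n) ℝ) {a : Fin n → ℝ}
    (ha : ∀ i, 0 ≤ a i) : matSqrt (conjDiag Om a) = conjDiag Om fun i => √(a i) := by
  refine matSqrt_eq_of_mul_self (conjDiag_posSemidef fun i => Real.sqrt_nonneg _) ?_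
  rw [conjDiag_mul hOm]
  simp only [fun i => Real.mul_self_sqrt (ha i)]

theorem trace_conjDiag (hOm : Om ∈ Matrix.orthogonalGroup (Fin n) ℝ) (a : Fin n → ℝ) :
    (conjDiag Om a).trace = ∑ i, a i := by
  rw [conjDiag, trace_conj hOm, Matrix.trace_diagonal]

theorem rank_conjDiag (hOm : Om ∈ Matrix.orthogonalGroup (Fin n) ℝ) (a : Fin n → ℝ) :
    (conjDiag Om a).rank = (Finset.univ.filter fun i => a i ≠ 0).card := by
  have h1 : Om.det * Omᵀ.det = 1 := by
    rw [← Matrix.det_mul, self_mul_transpose_of_mem hOm, Matrix.det_one]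
  rw [conjDiag, Matrix.rank_mul_eq_left_of_isUnit_det _ _ (IsUnit.of_mul_eq_one_right _ h1),
    Matrix.rank_mul_eq_right_of_isUnit_det _ _ (IsUnit.of_mul_eq_one _ h1), Matrix.rank_diagonal,
    Fintype.card_subtype]

/-- A matrix commuting with a diagonalizable matrix with simple spectrum is diagonal in the same
basis. -/
theorem exists_eq_conjDiag_of_commute (hOm : Om ∈ Matrix.orthogonalGroup (Fin n) ℝ)
    {lam : Fin n → ℝ} (hlam : Function.Injective lam) {K : Matrix (Fin n) (Fin n) ℝ}
    (h : K * conjDiag Om lam = conjDiag Om lam * K) : ∃ s, K = conjDiag Om s := by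
  have hK : K = Om * (Omᵀ * K * Om) * Omᵀ := by
    calc K = (Om * Omᵀ) * K * (Om * Omᵀ) := by
          rw [self_mul_transpose_of_mem hOm, Matrix.one_mul, Matrix.mul_one]
      _ = _ := by simp only [Matrix.mul_assoc]
  rw [hK, conjDiag, conj_mul_conj hOm, conj_mul_conj hOm] at h
  have h' := eq_of_conj_eq hOm h
  set M := Omᵀ * K * Om
  refine ⟨fun i => M i i, ?_⟩
  rw [hK, conjDiag]
  congr 2
  ext i j
  rcases eq_or_ne i j with rfl | hij
  · rw [Matrix.diagonal_apply_eq]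
  · rw [Matrix.diagonal_apply_ne _ hij]
    have := congrFun (congrFun h' i) j
    rw [Matrix.mul_diagonal, Matrix.diagonal_mul, mul_comm, ← sub_eq_zero, ← sub_mul] at this
    exact (mul_eq_zero.1 this).resolve_left (sub_ne_zero.2 fun e => hij (hlam e).symm)

theorem buresWassersteinSq_conjDiag (hOm : Om ∈ Matrix.orthogonalGroup (Fin n) ℝ)
    {lam D : Fin n → ℝ} (hl : ∀ i, 0 ≤ lam i) (hD : ∀ i, 0 ≤ D i) :
    buresWassersteinSq (conjDiag Om D) (conjDiag Om lam) = ∑ i, (√(lam i) - √(D i)) ^ 2 := by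
  have h : matSqrt (sandwich (conjDiag Om lam) (conjDiag Om D)) =
      conjDiag Om fun i => √(lam i) * √(D i) := by
    refine matSqrt_eq_of_mul_self
      (conjDiag_posSemidef fun i => mul_nonneg (Real.sqrt_nonneg _) (Real.sqrt_nonneg _)) ?_
    rw [sandwich, matSqrt_conjDiag hOm hl, conjDiag_mul hOm, conjDiag_mul hOm, conjDiag_mul hOm]
    congr 1
    funext i
    linear_combination √(lam i) ^ 2 * Real.mul_self_sqrt (hD i)
  rw [buresWassersteinSq_eq, h, trace_conjDiag hOm, trace_conjDiag hOm, trace_conjDiag hOm,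
    Finset.mul_sum, ← Finset.sum_add_distrib, ← Finset.sum_sub_distrib]
  refine Finset.sum_congr rfl fun i _ => ?_
  rw [sub_sq, Real.sq_sqrt (hl i), Real.sq_sqrt (hD i)]
  ring

end

/-! ### Plane rotations -/

section

variable {n : ℕ}

/-- The rotation by the angle `φ` in the plane of the coordinates `i` and `j`. -/
noncomputable def planeRotation (i j : Fin n) (φ : ℝ) : Matrix (Fin n) (Fin n) ℝ :=
  1 + (Real.cos φ - 1) • (Matrix.single i i 1 + Matrix.single j j 1) +
    Real.sin φ • (Matrix.single i j 1 - Matrix.single j i 1)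

theorem planeRotation_zero (i j : Fin n) : planeRotation i j 0 = 1 := by
  simp [planeRotation]

theorem continuous_planeRotation (i j : Fin n) : Continuous (planeRotation i j) := by
  unfold planeRotation
  fun_prop

theorem planeRotation_transpose_mul_self {i j : Fin n} (h : i ≠ j) (φ : ℝ) :
    (planeRotation i j φ)ᵀ * planeRotation i j φ = 1 := by
  have h1 : (planeRotation i j φ)ᵀ =
      1 + (Real.cos φ - 1) • (Matrix.single i i (1 : ℝ) + Matrix.single j j 1) -
        Real.sin φ • (Matrix.single i j 1 - Matrix.single j i 1) := by
    simp only [planeRotation, Matrix.transpose_add, Matrix.transpose_one, Matrix.transpose_smul,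
      Matrix.transpose_sub, Matrix.transpose_single]
    module
  -- `P` is the projection onto the plane and `X` a quarter turn in it; their four products reduce
  -- orthogonality to `sin² + cos² = 1`.
  have hPP : (Matrix.single i i (1 : ℝ) + Matrix.single j j 1) *
      (Matrix.single i i (1 : ℝ) + Matrix.single j j 1) =
      Matrix.single i i (1 : ℝ) + Matrix.single j j 1 := by
    simp [Matrix.add_mul, Matrix.mul_add, h, h.symm]
  have hPX : (Matrix.single i i (1 : ℝ) + Matrix.single j j 1) *
      (Matrix.single i j (1 : ℝ) - Matrix.single j i 1) =
      Matrix.single i j (1 : ℝ) - Matrix.single j i 1 := by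
    simp [Matrix.add_mul, Matrix.mul_sub, h, h.symm]
  have hXP : (Matrix.single i j (1 : ℝ) - Matrix.single j i 1) *
      (Matrix.single i i (1 : ℝ) + Matrix.single j j 1) =
      Matrix.single i j (1 : ℝ) - Matrix.single j i 1 := by
    simp [Matrix.sub_mul, Matrix.mul_add, h, h.symm]
    abel
  have hXX : (Matrix.single i j (1 : ℝ) - Matrix.single j i 1) *
      (Matrix.single i j (1 : ℝ) - Matrix.single j i 1) =
      -(Matrix.single i i (1 : ℝ) + Matrix.single j j 1) := by
    simp [Matrix.sub_mul, Matrix.mul_sub, h, h.symm]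
    abel
  rw [h1, planeRotation]
  generalize Matrix.single i i (1 : ℝ) + Matrix.single j j 1 = P at *
  generalize Matrix.single i j (1 : ℝ) - Matrix.single j i 1 = X at *
  simp only [Matrix.add_mul, Matrix.sub_mul, Matrix.mul_add, Matrix.one_mul, Matrix.mul_one,
    Matrix.smul_mul, Matrix.mul_smul, hPP, hPX, hXP, hXX]
  have hs : Real.sin φ * Real.sin φ = 1 - Real.cos φ * Real.cos φ := by
    nlinarith [Real.sin_sq_add_cos_sq φ]
  have : (Real.sin φ * Real.sin φ) • P = (1 - Real.cos φ * Real.cos φ) • P := by rw [hs]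
  linear_combination (norm := module) this

/-- The trace is bilinear in `a` and `b`, with the squared entries of the rotation as coefficients.
The correction is a gain when `a` and `b` are oppositely ordered at `i` and `j`. -/
theorem trace_diagonal_mul_planeRotation {i j : Fin n} (h : i ≠ j) (a b : Fin n → ℝ) (φ : ℝ) :
    (Matrix.diagonal a * (planeRotation i j φ * Matrix.diagonal b * (planeRotation i j φ)ᵀ)).trace =
      ∑ p, a p * b p + Real.sin φ ^ 2 * ((a i - a j) * (b j - b i)) := by
  have hsq : ∀ p q, planeRotation i j φ p q * planeRotation i j φ p q =
      (1 + Real.sin φ ^ 2 • (Matrix.single i j 1 + Matrix.single j i 1 - Matrix.single i i 1 -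
        Matrix.single j j 1) : Matrix (Fin n) (Fin n) ℝ) p q := by
    intro p q
    have hs := Real.sin_sq φ
    simp only [planeRotation, Matrix.add_apply, Matrix.smul_apply, Matrix.sub_apply,
      Matrix.single_apply, Matrix.one_apply, smul_eq_mul]
    rcases eq_or_ne p i with rfl | hp
    · rcases eq_or_ne q p with rfl | hq
      · simp [h.symm, hs]; ring
      · rcases eq_or_ne q j with rfl | hq'
        · simp [h, h.symm, sq]
        · simp [hq.symm, hq'.symm, h.symm]
    · rcases eq_or_ne p j with rfl | hp'
      · rcases eq_or_ne q p with rfl | hq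
        · simp [h, hs]; ring
        · rcases eq_or_ne q i with rfl | hq'
          · simp [h, h.symm, sq]
          · simp [hq.symm, hq'.symm, h]
      · simp [hp.symm, hp'.symm]
  have h1 : (Matrix.diagonal a *
      (planeRotation i j φ * Matrix.diagonal b * (planeRotation i j φ)ᵀ)).trace =
      a ⬝ᵥ ((1 + Real.sin φ ^ 2 • (Matrix.single i j 1 + Matrix.single j i 1 -
        Matrix.single i i 1 - Matrix.single j j 1) : Matrix (Fin n) (Fin n) ℝ) *ᵥ b) := by
    simp only [Matrix.trace, Matrix.diag_apply, Matrix.diagonal_mul, dotProduct, Matrix.mulVec,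
      ← hsq]
    refine Finset.sum_congr rfl fun p _ => ?_
    rw [Matrix.mul_apply]
    congr 1
    refine Finset.sum_congr rfl fun q _ => ?_
    rw [Matrix.mul_diagonal, Matrix.transpose_apply]
    ring
  rw [h1, Matrix.add_mulVec, dotProduct_add, Matrix.one_mulVec]
  simp only [Matrix.smul_mulVec, Matrix.add_mulVec, Matrix.sub_mulVec, Matrix.single_mulVec,
    dotProduct_smul, dotProduct_add, dotProduct_sub, smul_eq_mul]
  simp only [dotProduct, Function.update_apply, Pi.zero_apply, one_mul, mul_ite, mul_zero,
    Finset.sum_ite_eq', Finset.mem_univ, if_true]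
  ring

end

/-! ### Critical points and minimizers on the matrices of fixed rank -/

section

variable {n m : ℕ} {S₀ : Matrix (Fin n) (Fin n) ℝ} {τ : ℝ}

theorem mem_rankManifold {k : ℕ} {W : Matrix (Fin n) (Fin m) ℝ} :
    W ∈ rankManifold n m k ↔ W.rank = k := Iff.rfl

/-- A continuous curve of left multiples of `W` through `W` stays in the matrices of the same
rank. -/
theorem eventually_mul_mem_rankManifold (W : Matrix (Fin n) (Fin m) ℝ)
    {A : ℝ → Matrix (Fin n) (Fin n) ℝ} (hA : ContinuousAt A 0) (h0 : A 0 = 1) :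
    Filter.Tendsto (fun t => A t * W) (𝓝 0) (𝓝[rankManifold n m W.rank] W) := by
  have h1 : Filter.Tendsto (fun t => A t * W) (𝓝 0) (𝓝 W) := by
    have h2 : ContinuousAt (fun t => A t * W) 0 :=
      (continuous_id.matrix_mul (continuous_const (y := W))).continuousAt.comp hA
    have := h2.tendsto
    rwa [h0, Matrix.one_mul] at this
  refine tendsto_nhdsWithin_iff.2 ⟨h1, ?_⟩
  obtain ⟨_, _, _, _, _, _, h⟩ := W.exists_local_orbit_section
  filter_upwards [h1.eventually h] with t ht
  exact (Matrix.rank_mul_le_right _ _).antisymm ht.1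

/-- The first order optimality condition: the transport map fixes the range of a local
minimizer. -/
theorem transportMap_mul_eq_of_isLocalMinOn (h₀ : S₀.PosDef) (hτ : 0 < τ)
    {W : Matrix (Fin n) (Fin m) ℝ}
    (h : IsLocalMinOn (funcLoss S₀ τ) (rankManifold n m W.rank) W) :
    transportMap S₀ (W * Wᵀ + τ • 1) * W = W := by
  obtain ⟨L, hL, hLV⟩ := funcLoss_hasFDerivAt h₀ hτ W
  have hTT := transportMap_transpose h₀ (mul_transpose_add_smul_posDef hτ W)
  set T := transportMap S₀ (W * Wᵀ + τ • 1)
  have e (t : ℝ) : (1 + t • (1 - T)) * W = W + t • ((1 - T) * W) := by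
    rw [Matrix.add_mul, Matrix.one_mul, Matrix.smul_mul]
  -- The velocity `(1 - T) * W` is half the gradient. It is tangent to the stratum, since left
  -- multiplication preserves rank near `t = 0`, so the gradient itself must vanish.
  have hcurve := eventually_mul_mem_rankManifold W (A := fun t => 1 + t • (1 - T))
    (by fun_prop) (by simp)
  have hmin : IsLocalMin (fun t : ℝ => funcLoss S₀ τ (W + t • ((1 - T) * W))) 0 := by
    filter_upwards [hcurve.eventually h] with t ht
    simpa only [e, zero_smul, add_zero] using ht
  have hd : HasDerivAt (fun t : ℝ => funcLoss S₀ τ (W + t • ((1 - T) * W)))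
      (L ((1 - T) * W)) 0 := hL.hasLineDerivAt _
  have h1 := hmin.hasDerivAt_eq_zero hd
  rw [hLV] at h1
  have h2 : ‖(1 - T) * W‖ ^ 2 = 0 := by
    rw [frobenius_norm_sq_eq_trace, Matrix.transpose_mul, Matrix.transpose_sub,
      Matrix.transpose_one, hTT]
    linarith
  have h3 := norm_eq_zero.1 (pow_eq_zero_iff two_ne_zero |>.1 h2)
  rw [Matrix.sub_mul, Matrix.one_mul, sub_eq_zero] at h3
  exact h3.symm

variable {Om : Matrix (Fin n) (Fin n) ℝ} {lam : Fin n → ℝ}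

/-- At a local minimizer the covariance is diagonal in the eigenbasis of the target, and its
nonzero eigenvalues are those of the target shifted by `τ`. -/
theorem exists_conjDiag_of_isLocalMinOn (hOm : Om ∈ Matrix.orthogonalGroup (Fin n) ℝ)
    (hlam : Function.Injective lam) (hpos : ∀ i, 0 < lam i) (hτ : 0 < τ)
    {W : Matrix (Fin n) (Fin m) ℝ}
    (h : IsLocalMinOn (funcLoss (conjDiag Om lam) τ) (rankManifold n m W.rank) W) :
    ∃ s : Fin n → ℝ, W * Wᵀ = conjDiag Om s ∧ ∀ i, s i = 0 ∨ s i = lam i - τ := by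
  have h₀ := conjDiag_posDef hOm hpos
  have hTW := transportMap_mul_eq_of_isLocalMinOn h₀ hτ h
  have hS := mul_transpose_add_smul_posDef hτ W
  have hTT := transportMap_transpose h₀ hS
  have hTST := transportMap_mul_mul h₀ hS
  set T := transportMap (conjDiag Om lam) (W * Wᵀ + τ • 1)
  have hWT : Wᵀ * T = Wᵀ := by
    have := congrArg Matrix.transpose hTW
    rwa [Matrix.transpose_mul, hTT] at this
  set K := W * Wᵀ with hK
  have hTK : T * K = K := by rw [hK, ← Matrix.mul_assoc, hTW]
  have hKT : K * T = K := by rw [hK, Matrix.mul_assoc, hWT]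
  -- Since `T` fixes the range of `W`, the push-forward identity no longer involves `T` once
  -- multiplied by `K`.
  have hS₀ : conjDiag Om lam = K + τ • (T * T) := by
    rw [← hTST, Matrix.mul_add, Matrix.add_mul, hTK, hKT, Matrix.mul_smul, Matrix.mul_one,
      Matrix.smul_mul]
  have h1 : K * conjDiag Om lam = K * K + τ • K := by
    rw [hS₀, Matrix.mul_add, Matrix.mul_smul, ← Matrix.mul_assoc K T T, hKT, hKT]
  have h2 : conjDiag Om lam * K = K * K + τ • K := by
    rw [hS₀, Matrix.add_mul, Matrix.smul_mul, Matrix.mul_assoc T T K, hTK, hTK]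
  obtain ⟨s, hs⟩ := exists_eq_conjDiag_of_commute hOm hlam (h1.trans h2.symm)
  refine ⟨s, hs, fun i => ?_⟩
  have h3 : K * (K + τ • 1) = K * conjDiag Om lam := by
    rw [h1, Matrix.mul_add, Matrix.mul_smul, Matrix.mul_one]
  rw [hs, conjDiag_add_smul_one hOm, conjDiag_mul hOm, conjDiag_mul hOm] at h3
  have h4 := congrFun (Matrix.diagonal_injective (eq_of_conj_eq hOm h3)) i
  rcases mul_eq_mul_left_iff.1 h4 with h5 | h5
  · exact Or.inr (by linarith)
  · exact Or.inl h5

theorem funcLoss_eq_of_mul_transpose_eq (hOm : Om ∈ Matrix.orthogonalGroup (Fin n) ℝ)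
    (hpos : ∀ i, 0 < lam i) {W : Matrix (Fin n) (Fin m) ℝ} {s : Fin n → ℝ}
    (hW : W * Wᵀ = conjDiag Om s) (hs : ∀ i, 0 ≤ s i + τ) :
    funcLoss (conjDiag Om lam) τ W = ∑ i, (√(lam i) - √(s i + τ)) ^ 2 := by
  rw [funcLoss, covLoss, hW, conjDiag_add_smul_one hOm,
    buresWassersteinSq_conjDiag hOm (fun i => (hpos i).le) hs]

/-- A local minimizer selects the largest eigenvalues: otherwise rotating the plane of a selected
eigenvector and of an unselected one with a larger eigenvalue decreases the loss. -/
theorem ne_zero_of_lt_of_isLocalMinOn (hOm : Om ∈ Matrix.orthogonalGroup (Fin n) ℝ)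
    (hlam : StrictAnti lam) (hpos : ∀ i, 0 < lam i) (hτ : 0 < τ) (hτ_le : ∀ i, τ ≤ lam i)
    {W : Matrix (Fin n) (Fin m) ℝ}
    (h : IsLocalMinOn (funcLoss (conjDiag Om lam) τ) (rankManifold n m W.rank) W)
    {s : Fin n → ℝ} (hW : W * Wᵀ = conjDiag Om s) (hs : ∀ i, s i = 0 ∨ s i = lam i - τ)
    {i j : Fin n} (hij : i < j) (hj : s j ≠ 0) : s i ≠ 0 := by
  intro hi
  have hsτ : ∀ p, 0 ≤ s p + τ := fun p => by
    rcases hs p with hp | hp <;> rw [hp] <;> linarith [hpos p]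
  have hsj := (hs j).resolve_left hj
  have hlt : lam j < lam i := hlam hij
  -- A nonzero `s j` excludes `lam j = τ`, so the rotation lowers the loss strictly.
  have hjτ : τ < lam j := lt_of_le_of_ne (hτ_le j) fun e => hj (by rw [hsj]; linarith)
  have hcurve := eventually_mul_mem_rankManifold W
    (A := fun φ => Om * planeRotation i j φ * Omᵀ)
    ((continuous_const.matrix_mul (continuous_planeRotation i j)).matrix_mul
      continuous_const).continuousAt
    (by rw [planeRotation_zero, Matrix.mul_one, self_mul_transpose_of_mem hOm])
  obtain ⟨ε, hε, hball⟩ := Metric.eventually_nhds_iff.1 (hcurve.eventually h)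
  obtain ⟨φ, hφ0, hφ1⟩ := exists_between (lt_min hε Real.pi_pos)
  have hmin := hball (y := φ) (by
    rw [Real.dist_eq, sub_zero, abs_of_pos hφ0]; exact hφ1.trans_le (min_le_left _ _))
  have hsin : 0 < Real.sin φ := Real.sin_pos_of_pos_of_lt_pi hφ0 (hφ1.trans_le (min_le_right _ _))
  have hRT := planeRotation_transpose_mul_self hij.ne φ
  have htr := trace_diagonal_mul_planeRotation hij.ne (fun p => √(lam p)) (fun p => √(s p + τ)) φ
  set R := planeRotation i j φ
  have hRR : R * Rᵀ = 1 := mul_eq_one_comm.1 hRT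
  set W' := Om * R * Omᵀ * W with hW'
  have hS' : W' * W'ᵀ + τ • (1 : Matrix (Fin n) (Fin n) ℝ) =
      Om * (R * Matrix.diagonal (fun p => s p + τ) * Rᵀ) * Omᵀ := by
    have hd : Matrix.diagonal (fun p => s p + τ) =
        Matrix.diagonal s + τ • (1 : Matrix (Fin n) (Fin n) ℝ) := by
      rw [Matrix.smul_one_eq_diagonal, Matrix.diagonal_add]
    have h1 : W' * W'ᵀ = Om * (R * Matrix.diagonal s * Rᵀ) * Omᵀ := by
      calc W' * W'ᵀ = Om * R * Omᵀ * (W * Wᵀ) * (Om * Rᵀ * Omᵀ) := by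
            rw [hW']
            simp only [Matrix.transpose_mul, Matrix.transpose_transpose, Matrix.mul_assoc]
        _ = _ := by rw [hW, conjDiag, conj_mul_conj hOm, conj_mul_conj hOm]
    rw [h1, hd, Matrix.mul_add, Matrix.add_mul, Matrix.mul_add, Matrix.add_mul, Matrix.mul_smul,
      Matrix.mul_one, Matrix.smul_mul, hRR, Matrix.mul_smul, Matrix.mul_one, Matrix.smul_mul,
      self_mul_transpose_of_mem hOm]
  -- The rotated root is a factor of the rotated covariance. As a trial factor it bounds the
  -- fidelity from below, with no need for the square root of the sandwich.
  have hA : Om * (R * Matrix.diagonal (fun p => √(s p + τ)) * Rᵀ) * Omᵀ *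
      (Om * (R * Matrix.diagonal (fun p => √(s p + τ)) * Rᵀ) * Omᵀ)ᵀ =
      W' * W'ᵀ + τ • (1 : Matrix (Fin n) (Fin n) ℝ) := by
    have h1 : (Om * (R * Matrix.diagonal (fun p => √(s p + τ)) * Rᵀ) * Omᵀ)ᵀ =
        Om * (R * Matrix.diagonal (fun p => √(s p + τ)) * Rᵀ) * Omᵀ := by
      simp only [Matrix.transpose_mul, Matrix.transpose_transpose, Matrix.diagonal_transpose,
        Matrix.mul_assoc]
    have h2 : R * Matrix.diagonal (fun p => √(s p + τ)) * Rᵀ *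
        (R * Matrix.diagonal (fun p => √(s p + τ)) * Rᵀ) =
        R * Matrix.diagonal (fun p => s p + τ) * Rᵀ := by
      have h3 : Matrix.diagonal (fun p => s p + τ) = Matrix.diagonal (fun p => √(s p + τ)) *
          Matrix.diagonal (fun p => √(s p + τ)) := by
        rw [Matrix.diagonal_mul_diagonal]
        simp only [fun p => Real.mul_self_sqrt (hsτ p)]
      calc _ = R * Matrix.diagonal (fun p => √(s p + τ)) * (Rᵀ * R) *
            Matrix.diagonal (fun p => √(s p + τ)) * Rᵀ := by simp only [Matrix.mul_assoc]
        _ = _ := by rw [hRT, Matrix.mul_one, h3]; simp only [Matrix.mul_assoc]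
    rw [h1, conj_mul_conj hOm, h2, hS']
  have hle := trace_mul_le_trace_matSqrt_sandwich (conjDiag_posDef hOm hpos)
    (mul_transpose_add_smul_posDef hτ W') hA
  rw [matSqrt_conjDiag hOm (fun p => (hpos p).le), conjDiag, conj_mul_conj hOm, trace_conj hOm,
    htr] at hle
  have hval : funcLoss (conjDiag Om lam) τ W' ≤ ∑ p, (√(lam p) - √(s p + τ)) ^ 2 -
      2 * (Real.sin φ ^ 2 * ((√(lam i) - √(lam j)) * (√(s j + τ) - √(s i + τ)))) := by
    have h1 : (W' * W'ᵀ + τ • (1 : Matrix (Fin n) (Fin n) ℝ)).trace = ∑ p, (s p + τ) := by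
      rw [hS', trace_conj hOm, Matrix.trace_mul_comm, ← Matrix.mul_assoc, hRT, Matrix.one_mul,
        Matrix.trace_diagonal]
    have h2 : ∑ p, (√(lam p) - √(s p + τ)) ^ 2 = ∑ p, (s p + τ) + ∑ p, lam p -
        2 * ∑ p, √(lam p) * √(s p + τ) := by
      rw [Finset.mul_sum, ← Finset.sum_add_distrib, ← Finset.sum_sub_distrib]
      refine Finset.sum_congr rfl fun p _ => ?_
      rw [sub_sq, Real.sq_sqrt (hpos p).le, Real.sq_sqrt (hsτ p)]
      ring
    rw [funcLoss, covLoss, buresWassersteinSq_eq, h1, trace_conjDiag hOm, h2]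
    linarith
  have hlt' : 0 < Real.sin φ ^ 2 * ((√(lam i) - √(lam j)) * (√(s j + τ) - √(s i + τ))) := by
    refine mul_pos (pow_pos hsin 2) (mul_pos (sub_pos.2 ?_) (sub_pos.2 ?_))
    · exact Real.sqrt_lt_sqrt (hpos j).le hlt
    · rw [hi, hsj, zero_add, sub_add_cancel]
      exact Real.sqrt_lt_sqrt hτ.le hjτ
  have hmin' : funcLoss (conjDiag Om lam) τ W ≤ funcLoss (conjDiag Om lam) τ W' := hmin
  rw [funcLoss_eq_of_mul_transpose_eq hOm hpos hW hsτ] at hmin'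
  linarith

theorem Fin.mem_iff_lt_of_isLowerSet {J : Finset (Fin n)} (hJ : ∀ j ∈ J, ∀ i < j, i ∈ J)
    (i : Fin n) : i ∈ J ↔ (i : ℕ) < J.card := by
  constructor
  · intro hi
    have h1 : Finset.Iic i ⊆ J := fun p hp =>
      (Finset.mem_Iic.1 hp).eq_or_lt.elim (fun e => e ▸ hi) (hJ i hi p)
    have := Finset.card_le_card h1
    rw [Fin.card_Iic] at this
    omega
  · intro hi
    by_contra hiJ
    have h1 : J ⊆ Finset.Iio i := fun p hp => Finset.mem_Iio.2 (lt_of_not_ge fun hip =>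
      hip.eq_or_lt.elim (fun e => hiJ (e ▸ hp)) fun hlt => hiJ (hJ p hp i hlt))
    have := Finset.card_le_card h1
    rw [Fin.card_Iio] at this
    omega

/-- The covariance at a local minimizer on the matrices of rank `k`. -/
theorem mul_transpose_eq_of_isLocalMinOn (hOm : Om ∈ Matrix.orthogonalGroup (Fin n) ℝ)
    (hlam : StrictAnti lam) (hpos : ∀ i, 0 < lam i) (hτ : 0 < τ) (hτ_le : ∀ i, τ ≤ lam i)
    {k : ℕ} {W : Matrix (Fin n) (Fin m) ℝ} (hk : W.rank = k)
    (h : IsLocalMinOn (funcLoss (conjDiag Om lam) τ) (rankManifold n m k) W) :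
    W * Wᵀ = conjDiag Om fun i => if (i : ℕ) < k then lam i - τ else 0 := by
  subst hk
  obtain ⟨s, hW, hs⟩ := exists_conjDiag_of_isLocalMinOn hOm hlam.injective hpos hτ h
  have hcard : (Finset.univ.filter fun i => s i ≠ 0).card = W.rank := by
    rw [← rank_conjDiag hOm s, ← hW, Matrix.rank_self_mul_transpose]
  have hJ := Fin.mem_iff_lt_of_isLowerSet (J := Finset.univ.filter fun i => s i ≠ 0)
    fun j hj i hij => by
      rw [Finset.mem_filter_univ] at hj ⊢
      exact ne_zero_of_lt_of_isLocalMinOn hOm hlam hpos hτ hτ_le h hW hs hij hj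
  rw [hW]
  congr 1
  funext i
  have hi := hJ i
  rw [Finset.mem_filter_univ, hcard] at hi
  split_ifs with hik
  · exact (hs i).resolve_left (hi.2 hik)
  · exact not_not.1 fun hne => hik (hi.1 hne)

theorem funcLoss_eq_of_isLocalMinOn (hOm : Om ∈ Matrix.orthogonalGroup (Fin n) ℝ)
    (hlam : StrictAnti lam) (hpos : ∀ i, 0 < lam i) (hτ : 0 < τ) (hτ_le : ∀ i, τ ≤ lam i)
    {k : ℕ} {W : Matrix (Fin n) (Fin m) ℝ} (hk : W.rank = k)
    (h : IsLocalMinOn (funcLoss (conjDiag Om lam) τ) (rankManifold n m k) W) :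
    funcLoss (conjDiag Om lam) τ W =
      ∑ i : Fin n, if (i : ℕ) < k then 0 else (√(lam i) - √τ) ^ 2 := by
  rw [funcLoss_eq_of_mul_transpose_eq hOm hpos
    (mul_transpose_eq_of_isLocalMinOn hOm hlam hpos hτ hτ_le hk h)]
  · refine Finset.sum_congr rfl fun i _ => ?_
    split_ifs
    · rw [sub_add_cancel, sub_self, zero_pow two_ne_zero]
    · rw [zero_add]
  · intro i
    split_ifs
    · rw [sub_add_cancel]; exact (hpos i).le
    · rw [zero_add]; exact hτ.le

/-! ### Existence of minimizers of bounded rank and global optimality. -/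

theorem le_funcLoss (h₀ : S₀.PosDef) (hτ : 0 < τ) (W : Matrix (Fin n) (Fin m) ℝ) :
    1 / 2 * ‖W‖ ^ 2 - S₀.trace ≤ funcLoss S₀ τ W := by
  have h1 := le_buresWassersteinSq h₀ (mul_transpose_add_smul_posDef hτ W)
  rw [Matrix.trace_add, Matrix.trace_mul_comm, ← frobenius_norm_sq_eq_trace, Matrix.trace_smul,
    Matrix.trace_one, smul_eq_mul] at h1
  have : 0 ≤ τ * (Fintype.card (Fin n) : ℝ) := by positivity
  rw [funcLoss, covLoss]
  linarith

theorem exists_isMinOn_of_quadratic_bound {E : Type*} [NormedAddCommGroup E] [ProperSpace E]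
    {f : E → ℝ} (hf : Continuous f) {c : ℝ} (hc : ∀ x, 1 / 2 * ‖x‖ ^ 2 - c ≤ f x) {s : Set E}
    (hs : IsClosed s) {x₀ : E} (hx₀ : x₀ ∈ s) : ∃ x ∈ s, IsMinOn f s x := by
  refine hf.continuousOn.exists_isMinOn' hs hx₀ ?_
  refine Filter.Eventually.filter_mono inf_le_left ?_
  have h1 : Filter.Tendsto (fun x : E => ‖x‖ ^ 2) (Filter.cocompact E) Filter.atTop :=
    (Filter.tendsto_pow_atTop two_ne_zero).comp tendsto_norm_cocompact_atTop
  filter_upwards [h1.eventually_ge_atTop (2 * (f x₀ + c))] with x hx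
  linarith [hc x]

theorem exists_isMinOn_rank_le (h₀ : S₀.PosDef) (hτ : 0 < τ) (k : ℕ) :
    ∃ W : Matrix (Fin n) (Fin m) ℝ, W.rank ≤ k ∧
      ∀ W' : Matrix (Fin n) (Fin m) ℝ, W'.rank ≤ k → funcLoss S₀ τ W ≤ funcLoss S₀ τ W' := by
  have hf : Continuous (funcLoss (m := m) S₀ τ) := continuous_iff_continuousAt.2 fun W => by
    obtain ⟨L, hL, -⟩ := funcLoss_hasFDerivAt h₀ hτ W
    exact hL.continuousAt
  have : ProperSpace (Matrix (Fin n) (Fin m) ℝ) :=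
    FiniteDimensional.proper ℝ (Matrix (Fin n) (Fin m) ℝ)
  obtain ⟨W, hW, hmin⟩ := exists_isMinOn_of_quadratic_bound (E := Matrix (Fin n) (Fin m) ℝ) hf
    (le_funcLoss h₀ hτ) (Matrix.isClosed_rank_le k) (x₀ := 0) (by simp)
  exact ⟨W, hW, fun W' hW' => hmin hW'⟩

/-- Local minimizers on the matrices of rank `k` minimize the loss over all matrices of rank at
most `k`. -/
theorem funcLoss_le_of_isLocalMinOn (hOm : Om ∈ Matrix.orthogonalGroup (Fin n) ℝ)
    (hlam : StrictAnti lam) (hpos : ∀ i, 0 < lam i) (hτ : 0 < τ) (hτ_le : ∀ i, τ ≤ lam i)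
    {k : ℕ} {W : Matrix (Fin n) (Fin m) ℝ} (hk : W.rank = k)
    (h : IsLocalMinOn (funcLoss (conjDiag Om lam) τ) (rankManifold n m k) W)
    {W' : Matrix (Fin n) (Fin m) ℝ} (hW' : W'.rank ≤ k) :
    funcLoss (conjDiag Om lam) τ W ≤ funcLoss (conjDiag Om lam) τ W' := by
  -- The stratum of rank `k` need not be closed and may contain no minimizer, so the rank of `V` may
  -- be smaller than `k`. Its value then has additional nonnegative terms in the explicit sum.
  obtain ⟨V, hV, hmin⟩ := exists_isMinOn_rank_le (m := m) (conjDiag_posDef hOm hpos) hτ k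
  have hVmin : IsLocalMinOn (funcLoss (conjDiag Om lam) τ) (rankManifold n m V.rank) V := by
    filter_upwards [self_mem_nhdsWithin] with U hU
    exact hmin U ((mem_rankManifold.1 hU).trans_le hV)
  refine le_trans ?_ (hmin W' hW')
  rw [funcLoss_eq_of_isLocalMinOn hOm hlam hpos hτ hτ_le hk h,
    funcLoss_eq_of_isLocalMinOn hOm hlam hpos hτ hτ_le rfl hVmin]
  refine Finset.sum_le_sum fun i _ => ?_
  split_ifs with h1 h2 h2
  · exact le_rfl
  · positivity
  · omega
  · exact le_rfl

end

/-! ### Transfer between the parameter space and the end-to-end matrices -/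

/-- Derivatives within `M` need not be unique, but on the velocity of a curve in `M` each of them
equals the derivative of `f` along the curve; the one chosen by `fderivWithin` thus agrees there
with zero. -/
theorem isCriticalPointOn_of_hasFDerivWithinAt_zero {E : Type*} [NormedAddCommGroup E]
    [NormedSpace ℝ E] {f : E → ℝ} {M : Set E} {x : E} (hx : x ∈ M) (hf : Differentiable ℝ f)
    (h : HasFDerivWithinAt f (0 : E →L[ℝ] ℝ) M x) : IsCriticalPointOn f M x := by
  refine ⟨hx, hf.differentiableOn, ?_⟩
  rintro v ⟨γ, hγ, hγM, rfl, rfl⟩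
  have hd : HasDerivAt γ (deriv γ 0) 0 := (hγ.differentiableAt (by simp)).hasDerivAt
  have key {L : E →L[ℝ] ℝ} (hL : HasFDerivWithinAt f L M (γ 0)) :
      HasDerivAt (f ∘ γ) (L (deriv γ 0)) 0 := by
    have h1 : HasDerivWithinAt (f ∘ γ) (L (deriv γ 0)) {t | γ t ∈ M} 0 :=
      hL.comp_hasDerivWithinAt 0 hd.hasDerivWithinAt fun t ht => ht
    exact h1.hasDerivAt hγM
  exact (key (hf (γ 0)).differentiableWithinAt.hasFDerivWithinAt).unique (key h)

theorem hasFDerivWithinAt_zero_of_section {E F : Type*} [NormedAddCommGroup E] [NormedSpace ℝ E]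
    [NormedAddCommGroup F] [NormedSpace ℝ F] {f : E → ℝ} {g : F → ℝ} {s : E → F} {M : Set E}
    {x : E} (hx : x ∈ M) (hs : DifferentiableAt ℝ s x)
    (hg : HasFDerivAt g (0 : F →L[ℝ] ℝ) (s x)) (h : ∀ᶠ y in 𝓝 x, y ∈ M → g (s y) = f y) :
    HasFDerivWithinAt f (0 : E →L[ℝ] ℝ) M x := by
  have h1 : HasFDerivAt (g ∘ s) (0 : E →L[ℝ] ℝ) x := by
    have := hg.comp x hs.hasFDerivAt
    rwa [ContinuousLinearMap.zero_comp] at this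
  refine h1.hasFDerivWithinAt.congr_of_eventuallyEq ?_ (h.self_of_nhds hx).symm
  filter_upwards [nhdsWithin_le_nhds h, self_mem_nhdsWithin] with y hy hyM
  exact (hy hyM).symm

section

variable {d : ℕ → ℕ} {N : ℕ} {S₀ : Matrix (Fin (d (N + 1))) (Fin (d (N + 1))) ℝ} {τ : ℝ}

theorem isCriticalPointOn_of_isCriticalPoint (h₀ : S₀.PosDef) (hτ : 0 < τ)
    {θ : Params d (N + 1)} (h : IsCriticalPoint (paramLoss d (N + 1) S₀ τ) θ) :
    IsCriticalPointOn (funcLoss S₀ τ)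
      (rankManifold (d (N + 1)) (d 0) (endToEnd d (N + 1) θ).rank) (endToEnd d (N + 1) θ) := by
  obtain ⟨s, hs, hs0, hev⟩ := exists_local_section θ
  refine isCriticalPointOn_of_hasFDerivWithinAt_zero rfl (fun W => ?_) ?_
  · obtain ⟨L, hL, -⟩ := funcLoss_hasFDerivAt h₀ hτ W
    exact hL.differentiableAt
  · refine hasFDerivWithinAt_zero_of_section (g := paramLoss d (N + 1) S₀ τ) (s := s) rfl hs ?_ ?_
    · rw [hs0]; exact h
    · filter_upwards [hev] with W hW hWr
      rw [paramLoss, hW (mem_rankManifold.1 hWr).le]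

theorem isLocalMin_paramLoss_iff {θ : Params d (N + 1)}
    (hθ : (endToEnd d (N + 1) θ).rank = minWidth d (N + 1)) :
    IsLocalMin (paramLoss d (N + 1) S₀ τ) θ ↔
      IsLocalMinOn (funcLoss S₀ τ) (rankManifold (d (N + 1)) (d 0) (minWidth d (N + 1)))
        (endToEnd d (N + 1) θ) := by
  constructor
  · intro h
    obtain ⟨s, hs, hs0, hev⟩ := exists_local_section θ
    have h1 : Filter.Tendsto s (𝓝 (endToEnd d (N + 1) θ)) (𝓝 θ) := by
      have := hs.continuousAt.tendsto
      rwa [hs0] at this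
    filter_upwards [nhdsWithin_le_nhds (h1.eventually h), nhdsWithin_le_nhds hev,
      self_mem_nhdsWithin] with W hW hW' hWr
    rw [paramLoss, paramLoss, hW' ((mem_rankManifold.1 hWr).trans hθ.symm).le] at hW
    exact hW
  · intro h
    have h1 : Filter.Tendsto (endToEnd d (N + 1)) (𝓝 θ) (𝓝 (endToEnd d (N + 1) θ)) :=
      (differentiable_endToEnd d (N + 1) θ).continuousAt.tendsto
    obtain ⟨_, _, _, _, _, _, hr⟩ := (endToEnd d (N + 1) θ).exists_local_orbit_section
    -- Maximality of the rank enters here: semicontinuity bounds nearby ranks from below and the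
    -- minimal width bounds them from above.
    have h2 : Filter.Tendsto (endToEnd d (N + 1)) (𝓝 θ)
        (𝓝[rankManifold (d (N + 1)) (d 0) (minWidth d (N + 1))] (endToEnd d (N + 1) θ)) := by
      refine tendsto_nhdsWithin_iff.2 ⟨h1, ?_⟩
      filter_upwards [h1.eventually hr] with θ' hθ'
      exact (rank_endToEnd_le_minWidth θ').antisymm (hθ ▸ hθ'.1)
    exact h2.eventually h

end

theorem mainTheorem5 (N : ℕ) (hN : 1 ≤ N) (d : ℕ → ℕ)
    (S₀ Om : Matrix (Fin (d N)) (Fin (d N)) ℝ) (lam : Fin (d N) → ℝ)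
    (hOm : Om ∈ Matrix.orthogonalGroup (Fin (d N)) ℝ)
    (hS₀ : S₀ = Om * Matrix.diagonal lam * Omᵀ)
    (hlam : StrictAnti lam) (hpos : ∀ i, 0 < lam i)
    (τ : ℝ) (hτ : 0 < τ) (hτ_le : ∀ i, τ ≤ lam i) :
    (∀ θ : Params d N, IsCriticalPoint (paramLoss d N S₀ τ) θ →
      IsCriticalPointOn (funcLoss S₀ τ)
        (rankManifold (d N) (d 0) (endToEnd d N θ).rank) (endToEnd d N θ)) ∧
    (∀ θ : Params d N, (endToEnd d N θ).rank = minWidth d N →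
      (IsLocalMin (paramLoss d N S₀ τ) θ ↔
        IsLocalMinOn (funcLoss S₀ τ) (rankManifold (d N) (d 0) (minWidth d N))
          (endToEnd d N θ)) ∧
      (IsLocalMinOn (funcLoss S₀ τ) (rankManifold (d N) (d 0) (minWidth d N))
          (endToEnd d N θ) ↔
        IsMinOn (funcLoss S₀ τ) (rankManifold (d N) (d 0) (minWidth d N))
          (endToEnd d N θ)) ∧
      (IsLocalMin (paramLoss d N S₀ τ) θ →
        endToEnd d N θ * (endToEnd d N θ)ᵀ + τ • (1 : Matrix (Fin (d N)) (Fin (d N)) ℝ) =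
          Om * Matrix.diagonal (fun i : Fin (d N) => if (i : ℕ) < minWidth d N then lam i else τ)
            * Omᵀ)) := by
  obtain ⟨N, rfl⟩ := Nat.exists_eq_succ_of_ne_zero (Nat.one_le_iff_ne_zero.1 hN)
  obtain rfl : S₀ = conjDiag Om lam := hS₀
  refine ⟨fun θ hθ => isCriticalPointOn_of_isCriticalPoint (conjDiag_posDef hOm hpos) hτ hθ,
    fun θ hθ => ⟨isLocalMin_paramLoss_iff hθ, ⟨fun h => ?_, fun h => h.localize⟩, fun h => ?_⟩⟩
  · exact fun W' hW' =>
      funcLoss_le_of_isLocalMinOn hOm hlam hpos hτ hτ_le hθ h (mem_rankManifold.1 hW').le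
  · rw [mul_transpose_eq_of_isLocalMinOn hOm hlam hpos hτ hτ_le hθ
      ((isLocalMin_paramLoss_iff hθ).1 h), conjDiag_add_smul_one hOm, conjDiag]
    congr 3
    funext i
    split_ifs
    · rw [sub_add_cancel]
    · rw [zero_add]
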